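/- **Setting.** A *good observation scheme* consists of a Polish space $\Omega$ with a $\sigma$-finite Borel measure $P$ of full support; a convex relatively open set $\mathcal M\subset\mathbb R^M$ and probability densities $p_\mu$ ($\mu\in\mathcal M$) with respect to $P$, positive and jointly continuous on $\mathcal M\times\Omega$; and a finite-dimensional linear space $\mathcal F$ of continuous functions on $\Omega$ which contains the constants and all $\ln(p_\mu/p_\nu)$, such that $\ln\int e^{\phi}p_\mu\,dP$ is finite for $\phi\in\mathcal F$, $\mu\in\mathcal M$ and concave in $\mu\in\mathcal M$. Given are a good observation scheme, a convex compact set $\mathcal X\subset\mathbb R^n$, convex compact sets $X_1,\dots,X_I\subset\mathcal X$ with union $X$, an affine map $A$ with $A(\mathcal X)\subset\mathcal M$, and a continuous $f:\mathcal X\to\mathbb R$ which is $N$-convex: for every $a\in\mathbb R$, $\{x\in\mathcal X:f(x)\ge a\}=\bigcup_{\nu\le N}\mathcal X^{a,\ge}_\nu$ and $\{x\in\mathcal X:f(x)\le a\}=\bigcup_{\nu\le N}\mathcal X^{a,\le}_\nu$ with (possibly empty) closed convex sets, fixed once and for all. Given are also $a_0<b_0$ with $a_0\le f\le b_0$ on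 $X$. For $x\in X$ one observes $\omega^K=(\omega_1,\dots,\omega_K)$, i.i.d. with density $p_{A(x)}$. A Borel function $\widehat f:\Omega^K\to\mathbb R$ is *$(\rho,\epsilon)$-reliable* if for every $x\in X$, $|\widehat f(\omega^K)-f(x)|\le\rho$ with probability at least $1-\epsilon$. **Tests.** Let $Z^{a,\ge}_i$ (resp. $Z^{a,\le}_j$) be the nonempty sets among $X_k\cap\mathcal X^{a,\ge}_\nu$ (resp. $X_k\cap\mathcal X^{a,\le}_\nu$), $k\le I$, $\nu\le N$; $a$ is *upper-feasible* (resp. *lower-feasible*) if there is at least one. For $a<b$ with $a$ lower-feasible and $b$ upper-feasible, let $(r_{ij},s_{ij})$ maximize $\ln\int\sqrt{p_{A(r)}p_{A(s)}}\,dP$ over $r\in Z^{b,\ge}_i$, $s\in Z^{a,\le}_j$, let $\epsilon_{ij}=\int\sqrt{p_{A(r_{ij})}p_{A(s_{ij})}}\,dP$, $E=[\epsilon_{ij}^K]$, let $\sigma$ be the spectral norm of $E$, and let $[g;h]\ne0$ be nonnegative with $Eh=\sigma g$, $E^Tg=\sigma h$ (then $g,h>0$). The *color test* of $[a,b]$ says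 "right" iff for some $i$, for all $j$, $\sum_{t\le K}\frac12\ln\frac{p_{A(r_{ij})}(\omega_t)}{p_{A(s_{ij})}(\omega_t)}-\ln(h_j/g_i)\ge0$, and "left" otherwise. The *right test* of $[a,b]$ ($a$ lower-feasible) is the color test, with risk $\sigma$, if $b$ is upper-feasible; otherwise it always says "left" and has risk $0$. The *left test* of $[a,b]$ ($b$ upper-feasible) is the color test, with risk $\sigma$, if $a$ is lower-feasible; otherwise it always says "right" and has risk $0$. $[a,b]$ is *$\delta$-good (right)* if $a<b$, $a$ is lower-feasible and the right test has risk $\le\delta$; it is *$\delta$-good (left)* if $a<b$, $b$ is upper-feasible and the left test has risk $\le\delta$. **Bisection** with parameters $L,\delta,\varkappa$ starts from $\Delta_0=[a_0,b_0]$. Step $\ell=1,\dots,L$: let $\Delta_{\ell-1}=[a,b]$, $c=\frac{a+b}2$. If $c$ is not upper-feasible, $\Delta_\ell=[a,c]$; otherwise, if $c$ is not lower-feasible, $\Delta_\ell=[c,b]$. Otherwise, if $[c,b]$ is not $\delta$-good (right) or $[a,c]$ is not $\delta$-good (left), stop with output $[a,b]$. Otherwise let $v=b-(k-1)\varkappa$,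 $k$ being the first $k=0,1,\dots$ for which $[c,b-k\varkappa]$ is not $\delta$-good (right), and $u=a+(k'-1)\varkappa$, $k'$ being the first $k'=0,1,\dots$ for which $[a+k'\varkappa,c]$ is not $\delta$-good (left). Run the right test of $[c,v]$ and the left test of $[u,c]$ on $\omega^K$. If both say "right", $\Delta_\ell=[c,b]$; if both say "left", $\Delta_\ell=[a,c]$; if they disagree, stop with output $[u,v]$. If step $L$ is completed (or $L=0$), the output is $\Delta_L$. The output segment is denoted $\bar\Delta$, and the Bisection estimate of $f(x)$ is its midpoint. **Proposition.** Let $\epsilon\in(0,1/2)$. The maximizers $(r_{ij},s_{ij})$ and vectors $[g;h]$ used by the tests exist for every $K$, and for every choice of them the following holds. (i) For all positive integers $K,L$ and every $\varkappa>0$, Bisection with $L$, $\delta=\epsilon/(2L)$ and $\varkappa$ is $(1-\epsilon)$-reliable: for every $x\in X$, $f(x)\in\bar\Delta$ with probability at least $1-\epsilon$. (ii) Let $\bar\rho>0$ and a positive integer $\bar K$ be such that there is a $(\bar\rho,\epsilon)$-reliable estimate of $f(x)$, $x\in X$, via $\bar K$ observations, and let $\rho>2\bar\rho$. If $b_0-a_0>2\rho$,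 then the Bisection estimate with $$L=\left\lceil\log_2\frac{b_0-a_0}{2\rho}\right\rceil,\quad \delta=\frac{\epsilon}{2L},\quad \varkappa=\rho-2\bar\rho,\quad K=\left\lceil\frac{2\ln(2LNI/\epsilon)}{\ln([4\epsilon(1-\epsilon)]^{-1})}\,\bar K\right\rceil$$ observations is $(\rho,\epsilon)$-reliable. If $b_0-a_0\le2\rho$, one takes $L=0$ (no step is made and the estimate is $\frac{a_0+b_0}2$), and it is $(\rho,\epsilon)$-reliable for every $K$. -/

import Mathlib

open MeasureTheory

/-- A good observation scheme `((Ω, P), {p_μ : μ ∈ 𝓜}, 𝓕)`. The Polish space `Ω` carries its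
Borel sigma-algebra, and the parameters `μ` live in `ℝ^M`. -/
structure GoodObservationScheme (Ω : Type*) [TopologicalSpace Ω] [PolishSpace Ω]
    [MeasurableSpace Ω] [BorelSpace Ω] (M : ℕ) where
  /-- the reference measure -/
  P : Measure Ω
  sigmaFinite : SigmaFinite P
  /-- the support of `P` is the whole of `Ω` -/
  fullSupport : P.IsOpenPosMeasure
  /-- the parameter set -/
  params : Set (EuclideanSpace ℝ (Fin M))
  convex_params : Convex ℝ params
  relOpen_params : intrinsicInterior ℝ params = params
  /-- the densities with respect to `P`; only the values at `μ ∈ params` matter -/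
  p : EuclideanSpace ℝ (Fin M) → Ω → ℝ
  p_pos : ∀ μ ∈ params, ∀ ω, 0 < p μ ω
  p_continuousOn : ContinuousOn (Function.uncurry p) (params ×ˢ (Set.univ : Set Ω))
  p_integral : ∀ μ ∈ params, ∫ ω, p μ ω ∂P = 1
  /-- the finite-dimensional space `𝓕` of continuous functions on `Ω` -/
  space : Submodule ℝ C(Ω, ℝ)
  finiteDim_space : FiniteDimensional ℝ space
  const_mem : ∀ c : ℝ, ContinuousMap.const Ω c ∈ space
  logRatio_mem : ∀ μ ∈ params, ∀ ν ∈ params,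
    ∃ φ ∈ space, ∀ ω, φ ω = Real.log (p μ ω / p ν ω)
  /-- `Φ(φ; μ) = ln ∫ exp(φ) p_μ dP` is real-valued on `𝓕 × 𝓜` -/
  exp_integrable : ∀ φ ∈ space, ∀ μ ∈ params, Integrable (fun ω => Real.exp (φ ω) * p μ ω) P
  /-- `Φ(φ; μ)` is concave in `μ ∈ 𝓜` -/
  concave : ∀ φ ∈ space,
    ConcaveOn ℝ params (fun μ => Real.log (∫ ω, Real.exp (φ ω) * p μ ω ∂P))

namespace GoodObservationScheme

variable {Ω : Type*} [TopologicalSpace Ω] [PolishSpace Ω] [MeasurableSpace Ω] [BorelSpace Ω]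
  {M : ℕ}

/-- The law of `K` independent observations drawn from the density `p_μ`. -/
noncomputable def law (O : GoodObservationScheme Ω M) (μ : EuclideanSpace ℝ (Fin M)) (K : ℕ) :
    Measure (Fin K → Ω) :=
  Measure.pi fun _ => O.P.withDensity fun ω => ENNReal.ofReal (O.p μ ω)

/-- The Hellinger affinity `∫ √(p_μ p_ν) dP`. -/
noncomputable def affinity (O : GoodObservationScheme Ω M) (μ ν : EuclideanSpace ℝ (Fin M)) : ℝ :=
  ∫ ω, √(O.p μ ω * O.p ν ω) ∂O.P

/-- The detector `∑ t, (1/2) ln (p_μ(ω_t) / p_ν(ω_t))` for repeated observations. -/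
noncomputable def detector (O : GoodObservationScheme Ω M) (μ ν : EuclideanSpace ℝ (Fin M))
    {K : ℕ} (w : Fin K → Ω) : ℝ :=
  ∑ t, (1 / 2) * Real.log (O.p μ (w t) / O.p ν (w t))

end GoodObservationScheme

/-- The data of the estimation problem: a good observation scheme, a convex compact `dom ⊆ ℝ^n`,
convex compact sets `X i ⊆ dom`, an affine encoding `A` of `dom` into the parameter set, and a
continuous `N`-convex function `f` on `dom` together with the closed convex sets into which its
upper and lower level sets are decomposed (some of these sets may be empty or coincide). -/
structure EstimationProblem (Ω : Type*) [TopologicalSpace Ω] [PolishSpace Ω]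
    [MeasurableSpace Ω] [BorelSpace Ω] (M n I N : ℕ) where
  os : GoodObservationScheme Ω M
  dom : Set (EuclideanSpace ℝ (Fin n))
  convex_dom : Convex ℝ dom
  isCompact_dom : IsCompact dom
  X : Fin I → Set (EuclideanSpace ℝ (Fin n))
  convex_X : ∀ i, Convex ℝ (X i)
  isCompact_X : ∀ i, IsCompact (X i)
  X_subset : ∀ i, X i ⊆ dom
  A : EuclideanSpace ℝ (Fin n) →ᵃ[ℝ] EuclideanSpace ℝ (Fin M)
  A_mem : ∀ x ∈ dom, A x ∈ os.params
  f : EuclideanSpace ℝ (Fin n) → ℝ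
  f_continuousOn : ContinuousOn f dom
  upper : ℝ → Fin N → Set (EuclideanSpace ℝ (Fin n))
  lower : ℝ → Fin N → Set (EuclideanSpace ℝ (Fin n))
  upper_closed_convex : ∀ a k, IsClosed (upper a k) ∧ Convex ℝ (upper a k)
  lower_closed_convex : ∀ a k, IsClosed (lower a k) ∧ Convex ℝ (lower a k)
  upper_iUnion : ∀ a, {x | x ∈ dom ∧ a ≤ f x} = ⋃ k, upper a k
  lower_iUnion : ∀ a, {x | x ∈ dom ∧ f x ≤ a} = ⋃ k, lower a k

namespace EstimationProblem

variable {Ω : Type*} [TopologicalSpace Ω] [PolishSpace Ω] [MeasurableSpace Ω] [BorelSpace Ω]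
  {M n I N : ℕ}

/-- The set `X = ⋃ i, X i` of signals. -/
def signals (S : EstimationProblem Ω M n I N) : Set (EuclideanSpace ℝ (Fin n)) := ⋃ i, S.X i

/-- `(ρ, ε)`-reliability of an estimate of `f(x)`, `x ∈ X`, through `K` independent observations
drawn from `p_{A(x)}`. Estimates are Borel functions. -/
def IsReliable (S : EstimationProblem Ω M n I N) {K : ℕ} (est : (Fin K → Ω) → ℝ) (ρ ε : ℝ) :
    Prop :=
  Measurable est ∧
    ∀ x ∈ S.signals, 1 - ε ≤ (S.os.law (S.A x) K).real {w | |est w - S.f x| ≤ ρ}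

/-- Indices of the upper `a`-sets: the nonempty ones among `X i ∩ upper a k`. -/
def UpIdx (S : EstimationProblem Ω M n I N) (a : ℝ) : Type :=
  {q : Fin I × Fin N // (S.X q.1 ∩ S.upper a q.2).Nonempty}

/-- Indices of the lower `a`-sets: the nonempty ones among `X i ∩ lower a k`. -/
def LowIdx (S : EstimationProblem Ω M n I N) (a : ℝ) : Type :=
  {q : Fin I × Fin N // (S.X q.1 ∩ S.lower a q.2).Nonempty}

noncomputable instance fintypeUpIdx (S : EstimationProblem Ω M n I N) (a : ℝ) :
    Fintype (S.UpIdx a) :=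
  haveI : Finite (S.UpIdx a) :=
    inferInstanceAs (Finite {q : Fin I × Fin N // (S.X q.1 ∩ S.upper a q.2).Nonempty})
  Fintype.ofFinite _

noncomputable instance fintypeLowIdx (S : EstimationProblem Ω M n I N) (a : ℝ) :
    Fintype (S.LowIdx a) :=
  haveI : Finite (S.LowIdx a) :=
    inferInstanceAs (Finite {q : Fin I × Fin N // (S.X q.1 ∩ S.lower a q.2).Nonempty})
  Fintype.ofFinite _

/-- The upper `a`-sets. -/
def upSet (S : EstimationProblem Ω M n I N) (a : ℝ) (i : S.UpIdx a) :
    Set (EuclideanSpace ℝ (Fin n)) :=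
  S.X i.1.1 ∩ S.upper a i.1.2

/-- The lower `a`-sets. -/
def lowSet (S : EstimationProblem Ω M n I N) (a : ℝ) (j : S.LowIdx a) :
    Set (EuclideanSpace ℝ (Fin n)) :=
  S.X j.1.1 ∩ S.lower a j.1.2

/-- `a` is upper-feasible. -/
def UpperFeasible (S : EstimationProblem Ω M n I N) (a : ℝ) : Prop := Nonempty (S.UpIdx a)

/-- `a` is lower-feasible. -/
def LowerFeasible (S : EstimationProblem Ω M n I N) (a : ℝ) : Prop := Nonempty (S.LowIdx a)

/-- The matrix `[ε_ij ^ K]`, where `ε_ij` is the affinity of `p_{A(r_ij)}` and `p_{A(s_ij)}`. -/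
noncomputable def riskMatrix (S : EstimationProblem Ω M n I N) (K : ℕ) {ι κ : Type}
    (r s : ι → κ → EuclideanSpace ℝ (Fin n)) : Matrix ι κ ℝ :=
  Matrix.of fun i j => S.os.affinity (S.A (r i j)) (S.A (s i j)) ^ K

end EstimationProblem

/-- The spectral norm of a real matrix: its operator norm for the Euclidean norms. -/
noncomputable def spectralNorm₂ {ι κ : Type} [Fintype ι] [Fintype κ] (E : Matrix ι κ ℝ) : ℝ :=
  letI := Classical.decEq κ
  ‖(Matrix.toEuclideanLin E).toContinuousLinearMap‖

namespace EstimationProblem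

variable {Ω : Type*} [TopologicalSpace Ω] [PolishSpace Ω] [MeasurableSpace Ω] [BorelSpace Ω]
  {M n I N : ℕ}

/-- The optimal solutions and Perron-Frobenius eigenvectors that the tests are built from.
For every segment `[a, b]` with `a < b`, every upper `b`-set `Z_i` and every lower `a`-set `Z_j`,
the pair `(r a b i j, s a b i j)` is some maximizer of `ln ∫ √(p_{A(r)} p_{A(s)}) dP` over
`Z_i × Z_j`; if `a` is lower-feasible and `b` is upper-feasible, `[g a b; h a b]` is some nonzero
nonnegative eigenvector of `[0, E; Eᵀ, 0]` for the eigenvalue `‖E‖` (spectral norm), `E` being the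
matrix `[ε_ij ^ K]`. -/
structure TestChoice (S : EstimationProblem Ω M n I N) (K : ℕ) where
  r : ∀ a b : ℝ, S.UpIdx b → S.LowIdx a → EuclideanSpace ℝ (Fin n)
  s : ∀ a b : ℝ, S.UpIdx b → S.LowIdx a → EuclideanSpace ℝ (Fin n)
  mem : ∀ a b, a < b → ∀ (i : S.UpIdx b) (j : S.LowIdx a), (r a b i j, s a b i j) ∈ S.upSet b i ×ˢ S.lowSet a j
  isMaxOn : ∀ a b, a < b → ∀ (i : S.UpIdx b) (j : S.LowIdx a),
    IsMaxOn (fun q : EuclideanSpace ℝ (Fin n) × EuclideanSpace ℝ (Fin n) =>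
        Real.log (S.os.affinity (S.A q.1) (S.A q.2)))
      (S.upSet b i ×ˢ S.lowSet a j) (r a b i j, s a b i j)
  g : ∀ _ b : ℝ, S.UpIdx b → ℝ
  h : ∀ a _ : ℝ, S.LowIdx a → ℝ
  perron : ∀ a b, a < b → S.LowerFeasible a → S.UpperFeasible b →
    0 ≤ g a b ∧ 0 ≤ h a b ∧ (g a b ≠ 0 ∨ h a b ≠ 0) ∧
    (S.riskMatrix K (r a b) (s a b)).mulVec (h a b) =
      spectralNorm₂ (S.riskMatrix K (r a b) (s a b)) • g a b ∧
    (S.riskMatrix K (r a b) (s a b)).transpose.mulVec (g a b) =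
      spectralNorm₂ (S.riskMatrix K (r a b) (s a b)) • h a b

namespace TestChoice

variable {S : EstimationProblem Ω M n I N} {K : ℕ}

/-- The color inferring test for the segment `[a, b]` answers `right`: some row of the matrix
`φ_ij(w) - ln (h_j / g_i)` is nonnegative. -/
def ColorRight (T : S.TestChoice K) (a b : ℝ) (w : Fin K → Ω) : Prop :=
  ∃ i, ∀ j, 0 ≤ S.os.detector (S.A (T.r a b i j)) (S.A (T.s a b i j)) w
    - Real.log (T.h a b j / T.g a b i)

/-- The right test for `[a, b]` answers `right`; its negation is the answer `left`. -/
def RightTest (T : S.TestChoice K) (a b : ℝ) (w : Fin K → Ω) : Prop :=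
  S.UpperFeasible b ∧ T.ColorRight a b w

open Classical in
/-- The risk of the right test. -/
noncomputable def rightRisk (T : S.TestChoice K) (a b : ℝ) : ℝ :=
  if S.UpperFeasible b then spectralNorm₂ (S.riskMatrix K (T.r a b) (T.s a b)) else 0

/-- The left test for `[a, b]` answers `right`; its negation is the answer `left`. -/
def LeftTest (T : S.TestChoice K) (a b : ℝ) (w : Fin K → Ω) : Prop :=
  S.LowerFeasible a → T.RightTest a b w

open Classical in
/-- The risk of the left test. -/
noncomputable def leftRisk (T : S.TestChoice K) (a b : ℝ) : ℝ :=
  if S.LowerFeasible a then T.rightRisk a b else 0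

/-- The segment `[a, b]` is `δ`-good (right). -/
def GoodRight (T : S.TestChoice K) (δ a b : ℝ) : Prop :=
  S.LowerFeasible a ∧ a < b ∧ T.rightRisk a b ≤ δ

/-- The segment `[a, b]` is `δ`-good (left). -/
def GoodLeft (T : S.TestChoice K) (δ a b : ℝ) : Prop :=
  S.UpperFeasible b ∧ a < b ∧ T.leftRisk a b ≤ δ

/-- The right end `v` of the right separator `[c, v]`: with `k` the first index for which
`[c, b - k * ϰ]` is not `δ`-good (right), `v = b - (k - 1) * ϰ`. It is used only when `[c, b]` is
`δ`-good (right), so that `k ≥ 1`; such a `k` exists because `ϰ > 0`. -/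
noncomputable def sepRight (T : S.TestChoice K) (δ ϰ c b : ℝ) : ℝ :=
  b - ((sInf {k : ℕ | ¬ T.GoodRight δ c (b - k * ϰ)} : ℕ) - 1 : ℝ) * ϰ

/-- The left end `u` of the left separator `[u, c]`, mirroring `sepRight`. -/
noncomputable def sepLeft (T : S.TestChoice K) (δ ϰ a c : ℝ) : ℝ :=
  a + ((sInf {k : ℕ | ¬ T.GoodLeft δ (a + k * ϰ) c} : ℕ) - 1 : ℝ) * ϰ

open Classical in
/-- Bisection run on the observation `w` from the localizer `[a, b]`, with the given number of
steps still allowed; the value is the pair of endpoints of the output segment. -/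
noncomputable def bisection (T : S.TestChoice K) (δ ϰ : ℝ) (w : Fin K → Ω) :
    ℕ → ℝ → ℝ → ℝ × ℝ
  | 0, a, b => (a, b)
  | m + 1, a, b =>
    let c := (a + b) / 2
    if ¬ S.UpperFeasible c then T.bisection δ ϰ w m a c
    else if ¬ S.LowerFeasible c then T.bisection δ ϰ w m c b
    else if ¬ T.GoodRight δ c b then (a, b)
    else if ¬ T.GoodLeft δ a c then (a, b)
    else
      let v := T.sepRight δ ϰ c b
      let u := T.sepLeft δ ϰ a c
      if T.RightTest c v w ∧ T.LeftTest u c w then T.bisection δ ϰ w m c b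
      else if ¬ T.RightTest c v w ∧ ¬ T.LeftTest u c w then T.bisection δ ϰ w m a c
      else (u, v)

/-- The Bisection estimate of `f(x)`: the midpoint of the output segment of at most `L` steps of
Bisection started from the localizer `[a, b]`. -/
noncomputable def estimate (T : S.TestChoice K) (δ ϰ : ℝ) (L : ℕ) (a b : ℝ) (w : Fin K → Ω) : ℝ :=
  ((T.bisection δ ϰ w L a b).1 + (T.bisection δ ϰ w L a b).2) / 2

end TestChoice

end EstimationProblem

/-! ### Single observations: affinities, moments of detectors, saddle points -/

namespace GoodObservationScheme

open Filter Topology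

/-! Reliability rests on a saddle point property, `tilt_le_affinity`. If `(r, s)` maximizes the
affinity over a pair of convex sets, the detector `φ = (1/2) ln (p_{A(r)} / p_{A(s)})` satisfies `∫
exp(-φ) p_{A(x)} ≤ ε_rs` for every `x` in the first set, where `ε_rs` is the affinity at `(r, s)`,
and `∫ exp(φ) p_{A(x)} ≤ ε_rs` for every `x` in the second. Over `K` independent observations these
moments are raised to the power `K`. Markov's inequality and a union bound over a row or a column of
`E` then bound the error of the color test. The shifts `ln (h_j / g_i)` turn the union bounds into
`(E h)_i / g_i` and `(Eᵀ g)_j / h_j`, both equal to `σ`.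

In one step of Bisection, `f x` can be lost only through a wrong answer of one of two tests whose
risks are at most `δ`. A wrong answer counts only when `f x` lies outside the interior of the tested
segment. Summing over the steps gives `2 L δ = ε`, with no independence between steps.

Near-optimality comes from a two-point bound, `affinity_pow_le`. When `b - a > 2 ρbar`, a `(ρbar,
ε)`-reliable estimate separates any upper `b`-signal from any lower `a`-signal, which forces their
affinity to the power `Kbar` below `2 √(ε (1 - ε))`. With the prescribed `K` the entries of `E` are
at most `δ / (N I)`, so `σ ≤ δ` by `perron_value_le`. Hence a segment that is not good, but has the
feasible end its type requires, has length at most `2 ρbar`. An early stop therefore leaves a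
segment of length at most `2 (2 ρbar + ϰ) = 2 ρ`, and `L` halvings of `[a₀, b₀]` achieve the same
length. -/

lemma exp_half_log_mul {x y : ℝ} (hx : 0 < x) (hy : 0 < y) :
    Real.exp (1 / 2 * Real.log (x / y)) * y = √(x * y) := by
  rw [mul_comm (1 / 2 : ℝ), ← Real.rpow_def_of_pos (div_pos hx hy), ← Real.sqrt_eq_rpow]
  calc √(x / y) * y = √(x / y) * √(y ^ 2) := by rw [Real.sqrt_sq hy.le]
    _ = √(x / y * y ^ 2) := (Real.sqrt_mul (div_pos hx hy).le _).symm
    _ = √(x * y) := by congr 1; field_simp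

lemma sqrt_mul_le_half_add {x y : ℝ} (hx : 0 ≤ x) (hy : 0 ≤ y) : √(x * y) ≤ (x + y) / 2 := by
  rw [Real.sqrt_le_left (by positivity)]
  nlinarith [sq_nonneg (x - y)]

/-- Fatou's lemma for Bochner integrals of nonnegative functions. -/
lemma integral_le_of_tendsto_of_integral_le {Ω : Type*} [MeasurableSpace Ω] {F : ℕ → Ω → ℝ} {G : Ω → ℝ} {P : Measure Ω} {c : ℝ}
    (hF0 : ∀ k ω, 0 ≤ F k ω) (hFm : ∀ k, Measurable (F k)) (hFi : ∀ k, Integrable (F k) P)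
    (hGi : Integrable G P) (hlim : ∀ ω, Tendsto (fun k => F k ω) atTop (𝓝 (G ω)))
    {d : ℕ → ℝ} (hd : Tendsto d atTop (𝓝 c)) (hle : ∀ k, ∫ ω, F k ω ∂P ≤ d k) :
    ∫ ω, G ω ∂P ≤ c := by
  have hG0 : ∀ ω, 0 ≤ G ω := fun ω => ge_of_tendsto' (hlim ω) fun k => hF0 k ω
  have hd0 : ∀ k, 0 ≤ d k := fun k => (integral_nonneg (hF0 k)).trans (hle k)
  have hc0 : 0 ≤ c := ge_of_tendsto' hd hd0
  have h1 := lintegral_liminf_le (μ := P) (u := atTop)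
    (f := fun k ω => ENNReal.ofReal (F k ω)) fun k => (hFm k).ennreal_ofReal
  have h2 : ∀ ω, liminf (fun k => ENNReal.ofReal (F k ω)) atTop = ENNReal.ofReal (G ω) :=
    fun ω => (ENNReal.tendsto_ofReal (hlim ω)).liminf_eq
  simp_rw [h2] at h1
  have h3 : liminf (fun k => ∫⁻ ω, ENNReal.ofReal (F k ω) ∂P) atTop ≤ ENNReal.ofReal c := by
    rw [← (ENNReal.tendsto_ofReal hd).liminf_eq]
    refine liminf_le_liminf (Eventually.of_forall fun k => ?_)
    rw [← ofReal_integral_eq_lintegral_ofReal (hFi k) (Eventually.of_forall (hF0 k))]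
    exact ENNReal.ofReal_le_ofReal (hle k)
  rw [← ofReal_integral_eq_lintegral_ofReal hGi (Eventually.of_forall hG0)] at h1
  exact (ENNReal.ofReal_le_ofReal_iff hc0).1 (h1.trans h3)

lemma exp_two_half_log {x y : ℝ} (hx : 0 < x) (hy : 0 < y) :
    Real.exp (2 * (1 / 2 * Real.log (x / y))) * y = x := by
  rw [← mul_assoc]
  norm_num
  rw [Real.exp_log (div_pos hx hy), div_mul_cancel₀ _ hy.ne']

variable {Ω : Type*} [TopologicalSpace Ω] [PolishSpace Ω] [MeasurableSpace Ω] [BorelSpace Ω]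
  {M : ℕ} (O : GoodObservationScheme Ω M) {μ ν ξ : EuclideanSpace ℝ (Fin M)}

lemma continuous_p (hμ : μ ∈ O.params) : Continuous (O.p μ) := by
  have h : ContinuousOn (fun ω : Ω => Function.uncurry O.p (μ, ω)) Set.univ :=
    O.p_continuousOn.comp (by fun_prop) (fun ω _ => ⟨hμ, Set.mem_univ _⟩)
  simpa [continuousOn_univ] using h

lemma measurable_p (hμ : μ ∈ O.params) : Measurable (O.p μ) := (O.continuous_p hμ).measurable

lemma integrable_p (hμ : μ ∈ O.params) : Integrable (O.p μ) O.P := by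
  by_contra h
  have := O.p_integral μ hμ
  rw [integral_undef h] at this
  exact zero_ne_one this

lemma tendsto_p {u : ℕ → EuclideanSpace ℝ (Fin M)} (hu : ∀ k, u k ∈ O.params)
    (hμ : μ ∈ O.params) (h : Tendsto u atTop (𝓝 μ)) (ω : Ω) :
    Tendsto (fun k => O.p (u k) ω) atTop (𝓝 (O.p μ ω)) := by
  have h1 := O.p_continuousOn (μ, ω) ⟨hμ, Set.mem_univ _⟩
  have h2 : Tendsto (fun k => (u k, ω)) atTop (𝓝[O.params ×ˢ Set.univ] (μ, ω)) :=
    tendsto_nhdsWithin_iff.2 ⟨h.prodMk_nhds tendsto_const_nhds,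
      Eventually.of_forall fun k => ⟨hu k, Set.mem_univ _⟩⟩
  exact h1.tendsto.comp h2

lemma measure_ne_zero (hμ : μ ∈ O.params) : O.P ≠ 0 := by
  intro h
  have := O.p_integral μ hμ
  simp [h] at this

lemma integral_pos_of_pos (hμ : μ ∈ O.params) {F : Ω → ℝ} (hF : ∀ ω, 0 < F ω)
    (hi : Integrable F O.P) : 0 < ∫ ω, F ω ∂O.P := by
  rw [integral_pos_iff_support_of_nonneg (fun ω => (hF ω).le) hi]
  have : Function.support F = Set.univ := by
    ext ω; simp [(hF ω).ne']
  rw [this]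
  exact (Measure.measure_univ_pos).2 (O.measure_ne_zero hμ)

/-- The moment `∫ √(p_μ / p_ν) p_ξ dP` of the detector `(1/2) ln (p_μ / p_ν)`. -/
noncomputable def tilt (μ ν ξ : EuclideanSpace ℝ (Fin M)) : ℝ :=
  ∫ ω, Real.exp (1 / 2 * Real.log (O.p μ ω / O.p ν ω)) * O.p ξ ω ∂O.P

/-- The space `𝓕` is linear, so it contains the detector along with the log-ratio; this is what
makes the integrability and concavity axioms of the scheme apply to `tilt`. -/
lemma exists_half_logRatio (hμ : μ ∈ O.params) (hν : ν ∈ O.params) :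
    ∃ φ ∈ O.space, ∀ ω, φ ω = 1 / 2 * Real.log (O.p μ ω / O.p ν ω) := by
  obtain ⟨φ, hφ, h⟩ := O.logRatio_mem μ hμ ν hν
  exact ⟨(1 / 2 : ℝ) • φ, O.space.smul_mem _ hφ, fun ω => by simp [h ω]⟩

lemma integrable_tilt (hμ : μ ∈ O.params) (hν : ν ∈ O.params) (hξ : ξ ∈ O.params) :
    Integrable (fun ω => Real.exp (1 / 2 * Real.log (O.p μ ω / O.p ν ω)) * O.p ξ ω) O.P := by
  obtain ⟨φ, hφ, h⟩ := O.exists_half_logRatio hμ hν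
  simpa only [h] using O.exp_integrable φ hφ ξ hξ

lemma concaveOn_log_tilt (hμ : μ ∈ O.params) (hν : ν ∈ O.params) :
    ConcaveOn ℝ O.params fun ξ => Real.log (O.tilt μ ν ξ) := by
  obtain ⟨φ, hφ, h⟩ := O.exists_half_logRatio hμ hν
  simpa only [h, tilt] using O.concave φ hφ

lemma tilt_self (hμ : μ ∈ O.params) (hν : ν ∈ O.params) : O.tilt μ ν ν = O.affinity μ ν := by
  unfold tilt affinity
  exact integral_congr_ae (Eventually.of_forall fun ω =>
    exp_half_log_mul (O.p_pos μ hμ ω) (O.p_pos ν hν ω))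

lemma integrable_sqrt (hμ : μ ∈ O.params) (hν : ν ∈ O.params) :
    Integrable (fun ω => √(O.p μ ω * O.p ν ω)) O.P :=
  (O.integrable_tilt hμ hν hν).congr (Eventually.of_forall fun ω =>
    exp_half_log_mul (O.p_pos μ hμ ω) (O.p_pos ν hν ω))

lemma affinity_comm (μ ν : EuclideanSpace ℝ (Fin M)) : O.affinity μ ν = O.affinity ν μ := by
  unfold affinity
  simp_rw [mul_comm]

lemma tilt_pos (hμ : μ ∈ O.params) (hν : ν ∈ O.params) (hξ : ξ ∈ O.params) :
    0 < O.tilt μ ν ξ :=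
  O.integral_pos_of_pos hμ (fun ω => mul_pos (Real.exp_pos _) (O.p_pos ξ hξ ω))
    (O.integrable_tilt hμ hν hξ)

lemma affinity_pos (hμ : μ ∈ O.params) (hν : ν ∈ O.params) : 0 < O.affinity μ ν := by
  rw [← O.tilt_self hμ hν]
  exact O.tilt_pos hμ hν hν

lemma affinity_le_one (hμ : μ ∈ O.params) (hν : ν ∈ O.params) : O.affinity μ ν ≤ 1 := by
  have h : O.affinity μ ν ≤ ∫ ω, (O.p μ ω + O.p ν ω) / 2 ∂O.P :=
    integral_mono (O.integrable_sqrt hμ hν)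
      (((O.integrable_p hμ).add (O.integrable_p hν)).div_const 2)
      fun ω => sqrt_mul_le_half_add (O.p_pos μ hμ ω).le (O.p_pos ν hν ω).le
  rw [integral_div, integral_add (O.integrable_p hμ) (O.integrable_p hν), O.p_integral μ hμ,
    O.p_integral ν hν] at h
  linarith

/-- Upper semicontinuity of the affinity, along sequences. -/
lemma le_affinity_of_tendsto {u v : ℕ → EuclideanSpace ℝ (Fin M)} (hu : ∀ k, u k ∈ O.params)
    (hv : ∀ k, v k ∈ O.params) (hμ : μ ∈ O.params) (hν : ν ∈ O.params)
    (hul : Tendsto u atTop (𝓝 μ)) (hvl : Tendsto v atTop (𝓝 ν)) {c : ℝ}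
    (hc : Tendsto (fun k => O.affinity (u k) (v k)) atTop (𝓝 c)) : c ≤ O.affinity μ ν := by
  -- The densities converge only pointwise, without domination. Fatou still applies to the
  -- nonnegative gap between arithmetic and geometric means, whose integral is one minus the
  -- affinity.
  have key : ∀ {μ ν}, μ ∈ O.params → ν ∈ O.params →
      Integrable (fun ω => (O.p μ ω + O.p ν ω) / 2 - √(O.p μ ω * O.p ν ω)) O.P ∧
      ∫ ω, ((O.p μ ω + O.p ν ω) / 2 - √(O.p μ ω * O.p ν ω)) ∂O.P = 1 - O.affinity μ ν := by
    intro μ ν hμ hν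
    have h1 := ((O.integrable_p hμ).add (O.integrable_p hν)).div_const 2
    refine ⟨h1.sub (O.integrable_sqrt hμ hν), ?_⟩
    have h2 := integral_sub h1 (O.integrable_sqrt hμ hν)
    simp only [Pi.add_apply] at h2
    rw [h2, integral_div, integral_add (O.integrable_p hμ) (O.integrable_p hν),
      O.p_integral μ hμ, O.p_integral ν hν]
    simp [affinity]
  have h := integral_le_of_tendsto_of_integral_le (P := O.P)
    (F := fun k ω => (O.p (u k) ω + O.p (v k) ω) / 2 - √(O.p (u k) ω * O.p (v k) ω))
    (fun k ω => sub_nonneg.2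
      (sqrt_mul_le_half_add (O.p_pos _ (hu k) ω).le (O.p_pos _ (hv k) ω).le))
    (fun k => by
      have := O.measurable_p (hu k)
      have := O.measurable_p (hv k)
      fun_prop)
    (fun k => (key (hu k) (hv k)).1) (key hμ hν).1
    (fun ω => by
      have h1 := O.tendsto_p hu hμ hul ω
      have h2 := O.tendsto_p hv hν hvl ω
      exact ((h1.add h2).div_const 2).sub (h1.mul h2).sqrt)
    (hc.const_sub 1) (fun k => (key (hu k) (hv k)).2.le)
  rw [(key hμ hν).2] at h
  linarith

/-- The affinity attains its maximum over a nonempty compact set of pairs of parameters. -/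
lemma exists_affinity_max {C : Set (EuclideanSpace ℝ (Fin M) × EuclideanSpace ℝ (Fin M))}
    (hC : IsCompact C) (hne : C.Nonempty) (hsub : ∀ q ∈ C, q.1 ∈ O.params ∧ q.2 ∈ O.params) :
    ∃ q ∈ C, ∀ q' ∈ C, O.affinity q'.1 q'.2 ≤ O.affinity q.1 q.2 := by
  set A := (fun q : EuclideanSpace ℝ (Fin M) × EuclideanSpace ℝ (Fin M) =>
    O.affinity q.1 q.2) '' C with hA
  have hAne : A.Nonempty := hne.image _
  have hAb : BddAbove A := by
    refine ⟨1, ?_⟩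
    rintro _ ⟨q, hq, rfl⟩
    exact O.affinity_le_one (hsub q hq).1 (hsub q hq).2
  obtain ⟨y, -, hy, hyA⟩ := exists_seq_tendsto_sSup hAne hAb
  choose q hqC hq using hyA
  obtain ⟨q', hq', φ, hφ, hlim⟩ := hC.tendsto_subseq hqC
  refine ⟨q', hq', fun z hz => (le_csSup hAb ⟨z, hz, rfl⟩).trans ?_⟩
  refine O.le_affinity_of_tendsto (u := fun k => (q (φ k)).1) (v := fun k => (q (φ k)).2)
    (fun k => (hsub _ (hqC _)).1) (fun k => (hsub _ (hqC _)).2) (hsub _ hq').1 (hsub _ hq').2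
    ((continuous_fst.tendsto _).comp hlim) ((continuous_snd.tendsto _).comp hlim) ?_
  have : (fun k => O.affinity (q (φ k)).1 (q (φ k)).2) = y ∘ φ := funext fun k => hq (φ k)
  rw [this]
  exact hy.comp hφ.tendsto_atTop

/-- The integrand `√(p_ξ p_μ)` is the geometric mean of `√(p_μ / p_ν) p_ξ` and `√(p_ν / p_μ) p_μ`,
because the two ratios cancel. In the saddle point argument this replaces differentiation of the
affinity under the integral. -/
lemma affinity_le_tilt (hμ : μ ∈ O.params) (hν : ν ∈ O.params) (hξ : ξ ∈ O.params) :
    2 * O.affinity ξ μ ≤ O.tilt μ ν ξ + O.affinity ν μ := by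
  have h1 : ∀ ω, √(O.p ξ ω * O.p μ ω) ≤
      (Real.exp (1 / 2 * Real.log (O.p μ ω / O.p ν ω)) * O.p ξ ω +
        Real.exp (1 / 2 * Real.log (O.p ν ω / O.p μ ω)) * O.p μ ω) / 2 := by
    intro ω
    have h2 := O.p_pos ξ hξ ω
    have h3 := O.p_pos μ hμ ω
    refine le_trans (le_of_eq ?_) (sqrt_mul_le_half_add
      (mul_pos (Real.exp_pos (1 / 2 * Real.log (O.p μ ω / O.p ν ω))) h2).le
      (mul_pos (Real.exp_pos (1 / 2 * Real.log (O.p ν ω / O.p μ ω))) h3).le)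
    congr 1
    rw [mul_mul_mul_comm, ← Real.exp_add, ← inv_div (O.p μ ω), Real.log_inv]
    simp
  have i1 := O.integrable_tilt hμ hν hξ
  have i2 := O.integrable_tilt hν hμ hμ
  have h := integral_mono (O.integrable_sqrt hξ hμ) ((i1.add i2).div_const 2) h1
  simp only [Pi.add_apply] at h
  rw [integral_div, integral_add i1 i2] at h
  change O.affinity ξ μ ≤ (O.tilt μ ν ξ + O.tilt ν μ μ) / 2 at h
  rw [O.tilt_self hν hμ] at h
  linarith

/-- The saddle point property of the optimal detector: if `μ` maximizes the affinity with `ν` over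
a convex set, then the detector built from `μ, ν` has the moment bound on the whole set. -/
theorem tilt_le_affinity {C : Set (EuclideanSpace ℝ (Fin M))} (hC : Convex ℝ C)
    (hsub : C ⊆ O.params) (hν : ν ∈ O.params) (hμ : μ ∈ C)
    (hmax : ∀ ξ ∈ C, O.affinity ξ ν ≤ O.affinity μ ν) (hξ : ξ ∈ C) :
    O.tilt ν μ ξ ≤ O.affinity μ ν := by
  -- Tilting at `m`, slightly off the maximizer, avoids derivatives. Maximality gives `tilt ν m μ ≥
  -- 2 affinity μ ν - affinity m ν ≥ affinity m ν`, and `tilt ν m m = affinity m ν`. Concavity of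
  -- `log (tilt ν m ·)` on the segment from `μ` through `m` to `ξ` then keeps its value at `ξ` below
  -- `log (affinity m ν)`.
  have key : ∀ t : ℝ, 0 < t → t ≤ 1 →
      O.tilt ν ((1 - t) • μ + t • ξ) ξ ≤ O.affinity μ ν := by
    intro t ht ht1
    set m := (1 - t) • μ + t • ξ with hm
    have hmC : m ∈ C := hC hμ hξ (by linarith) ht.le (by ring)
    have h1 : O.affinity m ν ≤ O.tilt ν m μ := by
      have := O.affinity_le_tilt hν (hsub hmC) (hsub hμ)
      linarith [hmax m hmC]
    have h2 := (O.concaveOn_log_tilt hν (hsub hmC)).2 (hsub hμ) (hsub hξ)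
      (sub_nonneg.2 ht1) ht.le (by ring)
    rw [← hm] at h2
    simp only [smul_eq_mul] at h2
    rw [O.tilt_self hν (hsub hmC), O.affinity_comm ν m] at h2
    have h3 := Real.log_le_log (O.affinity_pos (hsub hmC) hν) h1
    have h4 : Real.log (O.tilt ν m ξ) ≤ Real.log (O.affinity m ν) := by
      have := mul_le_mul_of_nonneg_left h3 (sub_nonneg.2 ht1)
      nlinarith
    exact ((Real.log_le_log_iff (O.tilt_pos hν (hsub hmC) (hsub hξ))
      (O.affinity_pos (hsub hmC) hν)).1 h4).trans (hmax m hmC)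
  -- Letting `t → 0` brings `m` back to `μ`; Fatou's lemma passes the bound to the limit.
  set t : ℕ → ℝ := fun k => 1 / ((k : ℝ) + 1) with htdef
  have ht0 : ∀ k, 0 < t k := fun k => by positivity
  have ht1 : ∀ k, t k ≤ 1 := fun k => by
    rw [htdef]; simp only []
    rw [div_le_one (by positivity)]
    linarith [(Nat.cast_nonneg k : (0 : ℝ) ≤ k)]
  have htl : Tendsto t atTop (𝓝 0) := tendsto_one_div_add_atTop_nhds_zero_nat
  set u : ℕ → EuclideanSpace ℝ (Fin M) := fun k => (1 - t k) • μ + t k • ξ with hu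
  have huC : ∀ k, u k ∈ O.params := fun k =>
    hsub (hC hμ hξ (by linarith [ht1 k]) (ht0 k).le (by ring))
  have hul : Tendsto u atTop (𝓝 μ) := by
    have : Tendsto u atTop (𝓝 ((1 - (0 : ℝ)) • μ + (0 : ℝ) • ξ)) :=
      ((htl.const_sub 1).smul_const μ).add (htl.smul_const ξ)
    simpa using this
  refine integral_le_of_tendsto_of_integral_le
    (F := fun k ω => Real.exp (1 / 2 * Real.log (O.p ν ω / O.p (u k) ω)) * O.p ξ ω)
    (fun k ω => (mul_pos (Real.exp_pos _) (O.p_pos ξ (hsub hξ) ω)).le)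
    (fun k => ?_) (fun k => O.integrable_tilt hν (huC k) (hsub hξ))
    (O.integrable_tilt hν (hsub hμ) (hsub hξ)) (fun ω => ?_) tendsto_const_nhds
    (fun k => key (t k) (ht0 k) (ht1 k))
  · have := O.measurable_p (huC k)
    have := O.measurable_p hν
    have := O.measurable_p (hsub hξ)
    fun_prop
  · have h1 := O.tendsto_p huC (hsub hμ) hul ω
    have h2 : O.p ν ω / O.p μ ω ≠ 0 :=
      (div_pos (O.p_pos ν hν ω) (O.p_pos μ (hsub hμ) ω)).ne'
    exact ((Real.continuous_exp.tendsto _).comp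
      (((tendsto_const_nhds.div h1 (O.p_pos μ (hsub hμ) ω).ne').log h2).const_mul
        (1 / 2))).mul_const _

/-! ### Repeated observations: Chernoff's bound, likelihood ratios, the two-point bound -/

variable {K : ℕ}

/-- The law of a single observation. -/
noncomputable def obsLaw (μ : EuclideanSpace ℝ (Fin M)) : Measure Ω :=
  O.P.withDensity fun ω => ENNReal.ofReal (O.p μ ω)

lemma isProbabilityMeasure_obsLaw (hμ : μ ∈ O.params) : IsProbabilityMeasure (O.obsLaw μ) := by
  constructor
  rw [obsLaw, withDensity_apply _ MeasurableSet.univ, Measure.restrict_univ,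
    ← ofReal_integral_eq_lintegral_ofReal (O.integrable_p hμ)
      (Eventually.of_forall fun ω => (O.p_pos μ hμ ω).le), O.p_integral μ hμ, ENNReal.ofReal_one]

lemma law_eq_pi (μ : EuclideanSpace ℝ (Fin M)) (K : ℕ) :
    O.law μ K = Measure.pi fun _ : Fin K => O.obsLaw μ := rfl

lemma isProbabilityMeasure_law (hμ : μ ∈ O.params) (K : ℕ) :
    IsProbabilityMeasure (O.law μ K) := by
  have := O.isProbabilityMeasure_obsLaw hμ
  rw [law_eq_pi]
  infer_instance

lemma integral_obsLaw (hμ : μ ∈ O.params) (F : Ω → ℝ) :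
    ∫ ω, F ω ∂(O.obsLaw μ) = ∫ ω, F ω * O.p μ ω ∂O.P := by
  rw [obsLaw, integral_withDensity_eq_integral_toReal_smul (O.measurable_p hμ).ennreal_ofReal
    (Eventually.of_forall fun _ => ENNReal.ofReal_lt_top)]
  refine integral_congr_ae (Eventually.of_forall fun ω => ?_)
  simp only [ENNReal.toReal_ofReal (O.p_pos μ hμ ω).le, smul_eq_mul, mul_comm]

lemma integrable_obsLaw (hμ : μ ∈ O.params) (F : Ω → ℝ) :
    Integrable F (O.obsLaw μ) ↔ Integrable (fun ω => F ω * O.p μ ω) O.P := by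
  rw [obsLaw, integrable_withDensity_iff_integrable_smul' (O.measurable_p hμ).ennreal_ofReal
    (Eventually.of_forall fun _ => ENNReal.ofReal_lt_top)]
  refine integrable_congr (Eventually.of_forall fun ω => ?_)
  simp only [ENNReal.toReal_ofReal (O.p_pos μ hμ ω).le, smul_eq_mul, mul_comm]

lemma detector_neg (μ ν : EuclideanSpace ℝ (Fin M)) (w : Fin K → Ω) :
    -O.detector μ ν w = O.detector ν μ w := by
  unfold detector
  rw [← Finset.sum_neg_distrib]
  refine Finset.sum_congr rfl fun t _ => ?_
  rw [← inv_div (O.p μ (w t)), Real.log_inv]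
  ring

lemma measurable_detector (hμ : μ ∈ O.params) (hν : ν ∈ O.params) :
    Measurable (fun w : Fin K → Ω => O.detector μ ν w) := by
  have := O.measurable_p hμ
  have := O.measurable_p hν
  unfold detector
  fun_prop

lemma integrable_exp_detector (hμ : μ ∈ O.params) (hν : ν ∈ O.params) (hξ : ξ ∈ O.params) :
    Integrable (fun w : Fin K → Ω => Real.exp (O.detector μ ν w)) (O.law ξ K) := by
  have := O.isProbabilityMeasure_obsLaw hξ
  simp_rw [detector, Real.exp_sum, law_eq_pi]
  exact Integrable.fintype_prod (f := fun _ ω => Real.exp (1 / 2 * Real.log (O.p μ ω / O.p ν ω)))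
    fun _ => (O.integrable_obsLaw hξ _).2 (O.integrable_tilt hμ hν hξ)

lemma integral_exp_detector (hξ : ξ ∈ O.params) :
    ∫ w : Fin K → Ω, Real.exp (O.detector μ ν w) ∂(O.law ξ K) = O.tilt μ ν ξ ^ K := by
  have := O.isProbabilityMeasure_obsLaw hξ
  simp_rw [detector, Real.exp_sum, law_eq_pi]
  rw [integral_fintype_prod_eq_pow (fun ω => Real.exp (1 / 2 * Real.log (O.p μ ω / O.p ν ω))),
    O.integral_obsLaw hξ, Fintype.card_fin]
  rfl

/-- Chernoff's bound for the detector. -/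
lemma law_le_detector (hμ : μ ∈ O.params) (hν : ν ∈ O.params) (hξ : ξ ∈ O.params) (c : ℝ) :
    (O.law ξ K).real {w | c ≤ O.detector μ ν w} ≤ Real.exp (-c) * O.tilt μ ν ξ ^ K := by
  have h := mul_meas_ge_le_integral_of_nonneg (μ := O.law ξ K)
    (Eventually.of_forall fun w => (Real.exp_pos (O.detector μ ν w)).le)
    (O.integrable_exp_detector (K := K) hμ hν hξ) (Real.exp c)
  simp only [Real.exp_le_exp] at h
  rw [O.integral_exp_detector hξ] at h
  rw [Real.exp_neg, inv_mul_eq_div, le_div_iff₀ (Real.exp_pos c), mul_comm]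
  exact h

lemma integrable_exp_two_mul (hμ : μ ∈ O.params) (hν : ν ∈ O.params) :
    Integrable (fun ω => Real.exp (2 * (1 / 2 * Real.log (O.p μ ω / O.p ν ω)))) (O.obsLaw ν) := by
  rw [O.integrable_obsLaw hν]
  simp_rw [fun ω => exp_two_half_log (O.p_pos μ hμ ω) (O.p_pos ν hν ω)]
  exact O.integrable_p hμ

lemma setIntegral_exp_two_mul (hμ : μ ∈ O.params) (hν : ν ∈ O.params) {s : Set Ω}
    (hs : MeasurableSet s) :
    ∫ ω in s, Real.exp (2 * (1 / 2 * Real.log (O.p μ ω / O.p ν ω))) ∂(O.obsLaw ν) =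
      (O.obsLaw μ).real s := by
  rw [← integral_indicator hs, O.integral_obsLaw hν]
  have : ∀ ω, s.indicator (fun ω => Real.exp (2 * (1 / 2 * Real.log (O.p μ ω / O.p ν ω)))) ω
      * O.p ν ω = s.indicator (O.p μ) ω := by
    intro ω
    by_cases h : ω ∈ s
    · simp only [Set.indicator_of_mem h, exp_two_half_log (O.p_pos μ hμ ω) (O.p_pos ν hν ω)]
    · simp [Set.indicator_of_notMem h]
  simp_rw [this]
  rw [integral_indicator hs, measureReal_def, obsLaw, withDensity_apply _ hs,
    integral_eq_lintegral_of_nonneg_ae (Eventually.of_forall fun ω => (O.p_pos μ hμ ω).le)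
      (O.measurable_p hμ).aestronglyMeasurable]

lemma integrable_exp_two_mul_detector (hμ : μ ∈ O.params) (hν : ν ∈ O.params) :
    Integrable (fun w : Fin K → Ω => Real.exp (2 * O.detector μ ν w)) (O.law ν K) := by
  have := O.isProbabilityMeasure_obsLaw hν
  simp_rw [detector, Finset.mul_sum, Real.exp_sum, law_eq_pi]
  exact Integrable.fintype_prod
    (f := fun _ ω => Real.exp (2 * (1 / 2 * Real.log (O.p μ ω / O.p ν ω))))
    fun _ => O.integrable_exp_two_mul hμ hν

/-- The likelihood ratio of two laws of repeated observations. -/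
lemma law_eq_withDensity (hμ : μ ∈ O.params) (hν : ν ∈ O.params) :
    O.law μ K = (O.law ν K).withDensity
      fun w => ENNReal.ofReal (Real.exp (2 * O.detector μ ν w)) := by
  have := O.isProbabilityMeasure_obsLaw hν
  have := O.isProbabilityMeasure_obsLaw hμ
  rw [law_eq_pi]
  refine Measure.pi_eq fun s hs => ?_
  rw [withDensity_apply _ (MeasurableSet.univ_pi hs),
    ← ofReal_integral_eq_lintegral_ofReal (O.integrable_exp_two_mul_detector hμ hν).integrableOn
      (Eventually.of_forall fun w => (Real.exp_pos _).le), law_eq_pi, Measure.restrict_pi_pi]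
  simp_rw [detector, Finset.mul_sum, Real.exp_sum]
  rw [integral_fintype_prod_eq_prod
    (f := fun _ ω => Real.exp (2 * (1 / 2 * Real.log (O.p μ ω / O.p ν ω))))]
  simp_rw [fun t => O.setIntegral_exp_two_mul hμ hν (hs t)]
  rw [ENNReal.ofReal_prod_of_nonneg fun _ _ => measureReal_nonneg]
  simp

lemma setIntegral_exp_two_mul_detector (hμ : μ ∈ O.params) (hν : ν ∈ O.params)
    {B : Set (Fin K → Ω)} (hB : MeasurableSet B) :
    ∫ w in B, Real.exp (2 * O.detector μ ν w) ∂(O.law ν K) = (O.law μ K).real B := by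
  rw [measureReal_def, O.law_eq_withDensity hμ hν, withDensity_apply _ hB,
    integral_eq_lintegral_of_nonneg_ae (Eventually.of_forall fun ω => (Real.exp_pos _).le)]
  exact ((O.measurable_detector hμ hν).const_mul 2).exp.aestronglyMeasurable

/-- Weighted AM-GM: `exp φ ≤ (l exp(2 φ) + l⁻¹) / 2`, where `exp(2 φ)` is the likelihood ratio. The
weight `l` is left free because an event and its complement call for reciprocal weights. -/
lemma setIntegral_exp_detector_le (hμ : μ ∈ O.params) (hν : ν ∈ O.params)
    {B : Set (Fin K → Ω)} (hB : MeasurableSet B) {l : ℝ} (hl : 0 < l) :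
    ∫ w in B, Real.exp (O.detector μ ν w) ∂(O.law ν K) ≤
      (l * (O.law μ K).real B + l⁻¹ * (O.law ν K).real B) / 2 := by
  have := O.isProbabilityMeasure_law hν K
  have i2 := (O.integrable_exp_two_mul_detector (K := K) hμ hν).integrableOn (s := B)
  have i3 : Integrable (fun w : Fin K → Ω => (l * Real.exp (2 * O.detector μ ν w) + l⁻¹) / 2)
      ((O.law ν K).restrict B) := ((i2.const_mul l).add (integrable_const _)).div_const 2
  have h := integral_mono (O.integrable_exp_detector (K := K) hμ hν hν).integrableOn i3
    (fun w => by
      change Real.exp (O.detector μ ν w) ≤ (l * Real.exp (2 * O.detector μ ν w) + l⁻¹) / 2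
      rw [two_mul, Real.exp_add]
      set x := Real.exp (O.detector μ ν w)
      have : (l * (x * x) + l⁻¹) / 2 - x = l⁻¹ * (l * x - 1) ^ 2 / 2 := by
        field_simp
        ring
      have : 0 ≤ l⁻¹ * (l * x - 1) ^ 2 / 2 := by positivity
      linarith)
  rw [integral_div, integral_add (i2.const_mul l) (integrable_const _), integral_const_mul,
    O.setIntegral_exp_two_mul_detector hμ hν hB, integral_const] at h
  simpa [mul_comm] using h

/-- If some event separates two laws of repeated observations with errors at most `ε`, then
the Hellinger affinity of these laws is at most `2 √(ε (1 - ε))`. -/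
theorem affinity_pow_le (hμ : μ ∈ O.params) (hν : ν ∈ O.params) {B : Set (Fin K → Ω)}
    (hB : MeasurableSet B) {ε : ℝ} (hε : 0 < ε) (hε' : ε < 1 / 2)
    (h1 : 1 - ε ≤ (O.law μ K).real B) (h2 : 1 - ε ≤ (O.law ν K).real Bᶜ) :
    O.affinity μ ν ^ K ≤ 2 * √(ε * (1 - ε)) := by
  have := O.isProbabilityMeasure_law hν K
  have := O.isProbabilityMeasure_law hμ K
  have hi := O.integrable_exp_detector (K := K) hμ hν hν
  rw [← O.tilt_self hμ hν, ← O.integral_exp_detector hν, ← integral_add_compl hB hi]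
  set x := √ε
  set y := √(1 - ε)
  have hx : 0 < x := Real.sqrt_pos.2 hε
  have hy : 0 < y := Real.sqrt_pos.2 (by linarith)
  have hx2 : x ^ 2 = ε := Real.sq_sqrt hε.le
  have hy2 : y ^ 2 = 1 - ε := Real.sq_sqrt (by linarith)
  have hxy : x ≤ y := Real.sqrt_le_sqrt (by linarith)
  -- The small weight goes with the large probability: `√ε / √(1 - ε)` multiplies the law of `μ` on
  -- `B`, and the reciprocal multiplies it on the complement.
  have e1 := O.setIntegral_exp_detector_le hμ hν hB (div_pos hx hy)
  have e2 := O.setIntegral_exp_detector_le hμ hν hB.compl (div_pos hy hx)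
  rw [inv_div] at e1 e2
  have c1 : (O.law μ K).real Bᶜ = 1 - (O.law μ K).real B := by
    rw [measureReal_compl hB]; simp
  have c2 : (O.law ν K).real B = 1 - (O.law ν K).real Bᶜ := by
    rw [measureReal_compl hB]; simp
  rw [c1] at e2
  rw [c2] at e1
  rw [Real.sqrt_mul hε.le]
  set p := (O.law μ K).real B
  set q := (O.law ν K).real Bᶜ
  -- The sum of the two bounds is `((x/y) (p + q) + (y/x) (2 - p - q)) / 2`, which decreases in `p +
  -- q`; at the extreme value `p + q = 2 (1 - ε)` it equals `2 x y`.
  have hle : x / y ≤ y / x := by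
    rw [div_le_div_iff₀ hy hx]; nlinarith
  have e3 : x / y * (2 * y ^ 2) + y / x * (2 * x ^ 2) = 4 * (x * y) := by
    field_simp; ring
  have e4 : 0 ≤ (y / x - x / y) * ((p + q) - 2 * (1 - ε)) :=
    mul_nonneg (sub_nonneg.2 hle) (by linarith)
  rw [hx2, hy2] at e3
  change _ ≤ 2 * (x * y)
  linarith

end GoodObservationScheme

/-! ### Perron–Frobenius vectors and the spectral norm -/

section PerronFrobenius

variable {ι κ : Type} [Fintype ι] [Fintype κ]

lemma spectralNorm₂_nonneg (E : Matrix ι κ ℝ) : 0 ≤ spectralNorm₂ E := norm_nonneg _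

/-- A continuous linear map from a nontrivial finite-dimensional space attains its norm. -/
lemma ContinuousLinearMap.exists_norm_apply_eq_opNorm {V W : Type*} [NormedAddCommGroup V]
    [NormedSpace ℝ V] [FiniteDimensional ℝ V] [Nontrivial V] [NormedAddCommGroup W]
    [NormedSpace ℝ W] (T : V →L[ℝ] W) : ∃ x : V, ‖x‖ = 1 ∧ ‖T x‖ = ‖T‖ := by
  have : ProperSpace V := FiniteDimensional.proper ℝ V
  obtain ⟨x, hx, hmax⟩ := (isCompact_sphere (0 : V) 1).exists_isMaxOn
    (NormedSpace.sphere_nonempty.2 zero_le_one) (f := fun x => ‖T x‖) (by fun_prop)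
  have hx1 : ‖x‖ = 1 := by simpa using hx
  refine ⟨x, hx1, le_antisymm ?_ ?_⟩
  · simpa [hx1] using T.le_opNorm x
  · exact T.opNorm_le_of_unit_norm (norm_nonneg _) fun y hy => hmax (by simpa using hy)

/-- At a unit vector where `T` attains its norm, `T† T x = ‖T‖² x`. -/
lemma ContinuousLinearMap.adjoint_apply_eq_of_norm_apply_eq {V W : Type*}
    [NormedAddCommGroup V] [InnerProductSpace ℝ V] [CompleteSpace V] [NormedAddCommGroup W]
    [InnerProductSpace ℝ W] [CompleteSpace W] (T : V →L[ℝ] W) {x : V} (hx : ‖x‖ = 1)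
    (hT : ‖T x‖ = ‖T‖) :
    ContinuousLinearMap.adjoint T (T x) = ‖T‖ ^ 2 • x := by
  have h1 : ‖ContinuousLinearMap.adjoint T (T x)‖ ≤ ‖T‖ ^ 2 := by
    have h := (ContinuousLinearMap.adjoint T).le_opNorm (T x)
    rwa [LinearIsometryEquiv.norm_map, hT, ← sq] at h
  have h2 : inner ℝ (ContinuousLinearMap.adjoint T (T x)) x = ‖T‖ ^ 2 := by
    rw [ContinuousLinearMap.adjoint_inner_left, real_inner_self_eq_norm_sq, hT]
  have h3 := norm_sub_sq_real (ContinuousLinearMap.adjoint T (T x)) (‖T‖ ^ 2 • x)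
  rw [inner_smul_right, h2, norm_smul, hx, Real.norm_of_nonneg (by positivity)] at h3
  have h4 : ‖ContinuousLinearMap.adjoint T (T x)‖ ^ 2 ≤ (‖T‖ ^ 2) ^ 2 :=
    pow_le_pow_left₀ (norm_nonneg _) h1 2
  -- The squared distance expands to `‖T† T x‖² - ‖T‖⁴`.
  have h5 : ‖ContinuousLinearMap.adjoint T (T x) - ‖T‖ ^ 2 • x‖ ^ 2 ≤ 0 := by
    rw [h3]; linarith
  exact sub_eq_zero.1 (norm_eq_zero.1 (pow_eq_zero_iff two_ne_zero |>.1
    (le_antisymm h5 (sq_nonneg _))))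

/-- Existence of Perron–Frobenius vectors of `[0, E; Eᵀ, 0]` for a nonnegative matrix `E`. -/
theorem exists_perron_vectors [Nonempty κ] (E : Matrix ι κ ℝ) (hE : ∀ i j, 0 ≤ E i j) :
    ∃ (g : ι → ℝ) (h : κ → ℝ), 0 ≤ g ∧ 0 ≤ h ∧ (g ≠ 0 ∨ h ≠ 0) ∧
      E.mulVec h = spectralNorm₂ E • g ∧ E.transpose.mulVec g = spectralNorm₂ E • h := by
  classical
  set T := (Matrix.toEuclideanLin E).toContinuousLinearMap with hTdef
  have hσ : spectralNorm₂ E = ‖T‖ := by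
    unfold spectralNorm₂
    rw [hTdef]
  have happ : ∀ x, T x = WithLp.toLp 2 (E.mulVec (WithLp.ofLp x)) := fun x => rfl
  have hadj : ∀ y, ContinuousLinearMap.adjoint T y =
      WithLp.toLp 2 (E.transpose.mulVec (WithLp.ofLp y)) := by
    intro y
    have h := Matrix.toEuclideanLin_conjTranspose_eq_adjoint E
    rw [Matrix.conjTranspose_eq_transpose_of_trivial] at h
    have h' := congrArg (fun L => L y) h
    simp only [Matrix.toLpLin_apply] at h'
    rw [h']
    rfl
  obtain ⟨x, hx, hTx⟩ := T.exists_norm_apply_eq_opNorm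
  -- Replacing a norm-attaining vector by its entrywise absolute value keeps its norm and, since `E
  -- ≥ 0`, does not shrink its image.
  set z : EuclideanSpace ℝ κ := WithLp.toLp 2 fun j => |x j| with hz
  have hz1 : ‖z‖ = 1 := by
    rw [← hx, EuclideanSpace.norm_eq, EuclideanSpace.norm_eq]
    simp [hz]
  have hTz : ‖T z‖ = ‖T‖ := by
    refine le_antisymm (by simpa [hz1] using T.le_opNorm z) ?_
    rw [← hTx, EuclideanSpace.norm_eq, EuclideanSpace.norm_eq]
    refine Real.sqrt_le_sqrt (Finset.sum_le_sum fun i _ => ?_)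
    refine pow_le_pow_left₀ (norm_nonneg _) ?_ 2
    simp only [happ, Matrix.mulVec, dotProduct, hz, Real.norm_eq_abs]
    refine (Finset.abs_sum_le_sum_abs _ _).trans (le_trans (le_of_eq ?_) (le_abs_self _))
    exact Finset.sum_congr rfl fun j _ => by rw [abs_mul, abs_of_nonneg (hE i j)]
  have heig := T.adjoint_apply_eq_of_norm_apply_eq hz1 hTz
  rw [hadj, happ] at heig
  have heig' : E.transpose.mulVec (E.mulVec (WithLp.ofLp z)) = ‖T‖ ^ 2 • WithLp.ofLp z :=
    congrArg WithLp.ofLp heig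
  have hz0 : (0 : κ → ℝ) ≤ WithLp.ofLp z := fun j => abs_nonneg (x j)
  have hEz : (0 : ι → ℝ) ≤ E.mulVec (WithLp.ofLp z) := fun i =>
    Finset.sum_nonneg fun j _ => mul_nonneg (hE i j) (hz0 j)
  -- If `‖T‖ = 0`, the convention `0⁻¹ = 0` makes the first vector zero, and both equations still
  -- hold.
  refine ⟨‖T‖⁻¹ • E.mulVec (WithLp.ofLp z), WithLp.ofLp z,
    smul_nonneg (inv_nonneg.2 (norm_nonneg _)) hEz, hz0, Or.inr fun h => ?_, ?_, ?_⟩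
  · have : z = 0 := by
      apply (WithLp.ofLp_injective 2)
      simpa using h
    rw [this, norm_zero] at hz1
    exact zero_ne_one hz1
  · rw [hσ]
    rcases eq_or_ne ‖T‖ 0 with h0 | h0
    · have : T z = 0 := by rw [← norm_eq_zero, hTz, h0]
      rw [h0, zero_smul]
      exact congrArg WithLp.ofLp this
    · rw [smul_inv_smul₀ h0]
  · rw [hσ, Matrix.mulVec_smul, heig', smul_smul]
    rcases eq_or_ne ‖T‖ 0 with h0 | h0
    · simp [h0]
    · rw [sq, inv_mul_cancel_left₀ h0]

/-- Perron–Frobenius vectors of a positive matrix are positive, and so is the eigenvalue. -/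
theorem perron_vectors_pos [Nonempty ι] [Nonempty κ] {E : Matrix ι κ ℝ} (hE : ∀ i j, 0 < E i j)
    {g : ι → ℝ} {h : κ → ℝ} {σ : ℝ} (hσ : 0 ≤ σ) (hg : 0 ≤ g) (hh : 0 ≤ h)
    (hne : g ≠ 0 ∨ h ≠ 0) (h1 : E.mulVec h = σ • g) (h2 : E.transpose.mulVec g = σ • h) :
    0 < σ ∧ (∀ i, 0 < g i) ∧ ∀ j, 0 < h j := by
  -- A positive matrix sends a nonzero nonnegative vector to a strictly positive one, so one nonzero
  -- block forces `σ > 0` and positivity of the other block; a second application returns to the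
  -- first.
  have step : ∀ {ι κ : Type} [Fintype ι] [Fintype κ] [Nonempty ι] {E : Matrix ι κ ℝ}
      {g : ι → ℝ} {h : κ → ℝ}, (∀ i j, 0 < E i j) → 0 ≤ g → 0 ≤ h → h ≠ 0 →
      E.mulVec h = σ • g → 0 < σ ∧ ∀ i, 0 < g i := by
    intro ι κ _ _ _ E g h hE hg hh hne h1
    obtain ⟨j, hj⟩ := Function.ne_iff.1 hne
    have hpos : ∀ i, 0 < σ * g i := by
      intro i
      have : σ * g i = ∑ j, E i j * h j := (congrFun h1 i).symm
      rw [this]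
      exact Finset.sum_pos' (fun j _ => mul_nonneg (hE i j).le (hh j))
        ⟨j, Finset.mem_univ _, mul_pos (hE i j) (lt_of_le_of_ne (hh j) (Ne.symm hj))⟩
    have hp : ∀ i, 0 < σ ∧ 0 < g i := fun i => by
      rcases pos_and_pos_or_neg_and_neg_of_mul_pos (hpos i) with h | h
      · exact h
      · exact absurd h.1 (not_lt.2 hσ)
    exact ⟨(hp (Classical.arbitrary ι)).1, fun i => (hp i).2⟩
  have ne_of_pos : ∀ {ι : Type} [Nonempty ι] {g : ι → ℝ}, (∀ i, 0 < g i) → g ≠ 0 :=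
    fun {ι} _ {g} hg h => (hg (Classical.arbitrary ι)).ne' (congrFun h _)
  rcases hne with hne | hne
  · obtain ⟨hs, hh'⟩ := step (E := E.transpose) (fun i j => hE j i) hh hg hne h2
    exact ⟨hs, (step hE hg hh (ne_of_pos hh') h1).2, hh'⟩
  · obtain ⟨hs, hg'⟩ := step hE hg hh hne h1
    exact ⟨hs, hg', (step (E := E.transpose) (fun i j => hE j i) hh hg (ne_of_pos hg') h2).2⟩

/-- The eigenvalue for positive vectors is at most the size times the largest entry. -/
theorem perron_value_le [Nonempty ι] {E : Matrix ι κ ℝ} {m c : ℝ} (hm : 0 ≤ m)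
    (hE : ∀ i j, E i j ≤ m) (hι : (Fintype.card ι : ℝ) ≤ c) (hκ : (Fintype.card κ : ℝ) ≤ c)
    {g : ι → ℝ} {h : κ → ℝ} {σ : ℝ} (hg : ∀ i, 0 < g i) (hh : ∀ j, 0 < h j)
    (h1 : E.mulVec h = σ • g) (h2 : E.transpose.mulVec g = σ • h) : σ ≤ c * m := by
  have hgs : 0 < ∑ i, g i := Finset.sum_pos (fun i _ => hg i) Finset.univ_nonempty
  have hhs : 0 ≤ ∑ j, h j := Finset.sum_nonneg fun j _ => (hh j).le
  have e1 : σ * ∑ i, g i ≤ c * (m * ∑ j, h j) := by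
    rw [Finset.mul_sum]
    calc ∑ i, σ * g i ≤ ∑ _i : ι, m * ∑ j, h j := Finset.sum_le_sum fun i _ => by
          have : σ * g i = ∑ j, E i j * h j := (congrFun h1 i).symm
          rw [this, Finset.mul_sum]
          exact Finset.sum_le_sum fun j _ => mul_le_mul_of_nonneg_right (hE i j) (hh j).le
      _ = Fintype.card ι * (m * ∑ j, h j) := by simp
      _ ≤ _ := mul_le_mul_of_nonneg_right hι (by positivity)
  have e2 : σ * ∑ j, h j ≤ c * (m * ∑ i, g i) := by
    rw [Finset.mul_sum]
    calc ∑ j, σ * h j ≤ ∑ _j : κ, m * ∑ i, g i := Finset.sum_le_sum fun j _ => by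
          have : σ * h j = ∑ i, E i j * g i := (congrFun h2 j).symm
          rw [this, Finset.mul_sum]
          exact Finset.sum_le_sum fun i _ => mul_le_mul_of_nonneg_right (hE i j) (hg i).le
      _ = Fintype.card κ * (m * ∑ i, g i) := by simp
      _ ≤ _ := mul_le_mul_of_nonneg_right hκ (by positivity)
  -- Adding the two estimates puts the same total `∑ g + ∑ h` on both sides.
  refine le_of_mul_le_mul_right ?_ (add_pos_of_pos_of_nonneg hgs hhs)
  linarith

end PerronFrobenius

/-! ### Upper and lower sets; existence of the data of the tests -/

namespace EstimationProblem

variable {Ω : Type*} [TopologicalSpace Ω] [PolishSpace Ω] [MeasurableSpace Ω] [BorelSpace Ω]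
  {M n I N : ℕ} (S : EstimationProblem Ω M n I N)

lemma signals_subset_dom : S.signals ⊆ S.dom := Set.iUnion_subset S.X_subset

lemma upSet_subset_signals (a : ℝ) (i : S.UpIdx a) : S.upSet a i ⊆ S.signals :=
  fun _ hx => Set.mem_iUnion.2 ⟨_, hx.1⟩

lemma lowSet_subset_signals (a : ℝ) (j : S.LowIdx a) : S.lowSet a j ⊆ S.signals :=
  fun _ hx => Set.mem_iUnion.2 ⟨_, hx.1⟩

lemma A_mem_params {x : EuclideanSpace ℝ (Fin n)} (hx : x ∈ S.signals) : S.A x ∈ S.os.params :=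
  S.A_mem x (S.signals_subset_dom hx)

lemma isCompact_upSet (a : ℝ) (i : S.UpIdx a) : IsCompact (S.upSet a i) :=
  (S.isCompact_X _).inter_right (S.upper_closed_convex _ _).1

lemma isCompact_lowSet (a : ℝ) (j : S.LowIdx a) : IsCompact (S.lowSet a j) :=
  (S.isCompact_X _).inter_right (S.lower_closed_convex _ _).1

lemma convex_upSet (a : ℝ) (i : S.UpIdx a) : Convex ℝ (S.upSet a i) :=
  (S.convex_X _).inter (S.upper_closed_convex _ _).2

lemma convex_lowSet (a : ℝ) (j : S.LowIdx a) : Convex ℝ (S.lowSet a j) :=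
  (S.convex_X _).inter (S.lower_closed_convex _ _).2

lemma le_f_of_mem_upSet {a : ℝ} {i : S.UpIdx a} {x : EuclideanSpace ℝ (Fin n)}
    (hx : x ∈ S.upSet a i) : a ≤ S.f x := by
  have : x ∈ {x | x ∈ S.dom ∧ a ≤ S.f x} := by
    rw [S.upper_iUnion]
    exact Set.mem_iUnion.2 ⟨_, hx.2⟩
  exact this.2

lemma f_le_of_mem_lowSet {a : ℝ} {j : S.LowIdx a} {x : EuclideanSpace ℝ (Fin n)}
    (hx : x ∈ S.lowSet a j) : S.f x ≤ a := by
  have : x ∈ {x | x ∈ S.dom ∧ S.f x ≤ a} := by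
    rw [S.lower_iUnion]
    exact Set.mem_iUnion.2 ⟨_, hx.2⟩
  exact this.2

lemma exists_mem_upSet {a : ℝ} {x : EuclideanSpace ℝ (Fin n)} (hx : x ∈ S.signals)
    (h : a ≤ S.f x) : ∃ i, x ∈ S.upSet a i := by
  obtain ⟨k, hk⟩ := Set.mem_iUnion.1 hx
  have : x ∈ {x | x ∈ S.dom ∧ a ≤ S.f x} := ⟨S.signals_subset_dom hx, h⟩
  rw [S.upper_iUnion] at this
  obtain ⟨l, hl⟩ := Set.mem_iUnion.1 this
  exact ⟨⟨(k, l), x, hk, hl⟩, hk, hl⟩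

lemma exists_mem_lowSet {a : ℝ} {x : EuclideanSpace ℝ (Fin n)} (hx : x ∈ S.signals)
    (h : S.f x ≤ a) : ∃ j, x ∈ S.lowSet a j := by
  obtain ⟨k, hk⟩ := Set.mem_iUnion.1 hx
  have : x ∈ {x | x ∈ S.dom ∧ S.f x ≤ a} := ⟨S.signals_subset_dom hx, h⟩
  rw [S.lower_iUnion] at this
  obtain ⟨l, hl⟩ := Set.mem_iUnion.1 this
  exact ⟨⟨(k, l), x, hk, hl⟩, hk, hl⟩

lemma upperFeasible_of_le {a : ℝ} {x : EuclideanSpace ℝ (Fin n)} (hx : x ∈ S.signals)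
    (h : a ≤ S.f x) : S.UpperFeasible a :=
  ⟨(S.exists_mem_upSet hx h).choose⟩

lemma lowerFeasible_of_le {a : ℝ} {x : EuclideanSpace ℝ (Fin n)} (hx : x ∈ S.signals)
    (h : S.f x ≤ a) : S.LowerFeasible a :=
  ⟨(S.exists_mem_lowSet hx h).choose⟩

lemma card_upIdx_le (a : ℝ) : Fintype.card (S.UpIdx a) ≤ N * I := by
  have h : Function.Injective fun i : S.UpIdx a => i.1 := Subtype.val_injective
  simpa [mul_comm] using Fintype.card_le_of_injective _ h

lemma card_lowIdx_le (a : ℝ) : Fintype.card (S.LowIdx a) ≤ N * I := by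
  have h : Function.Injective fun j : S.LowIdx a => j.1 := Subtype.val_injective
  simpa [mul_comm] using Fintype.card_le_of_injective _ h

lemma exists_maximizer {a b : ℝ} (i : S.UpIdx b) (j : S.LowIdx a) :
    ∃ q ∈ S.upSet b i ×ˢ S.lowSet a j,
      IsMaxOn (fun q : EuclideanSpace ℝ (Fin n) × EuclideanSpace ℝ (Fin n) =>
        Real.log (S.os.affinity (S.A q.1) (S.A q.2))) (S.upSet b i ×ˢ S.lowSet a j) q := by
  have hmem : ∀ q ∈ S.upSet b i ×ˢ S.lowSet a j, S.A q.1 ∈ S.os.params ∧ S.A q.2 ∈ S.os.params :=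
    fun q hq => ⟨S.A_mem_params (S.upSet_subset_signals _ _ hq.1),
      S.A_mem_params (S.lowSet_subset_signals _ _ hq.2)⟩
  have hA : Continuous S.A := S.A.continuous_of_finiteDimensional
  have hc : IsCompact ((fun q : EuclideanSpace ℝ (Fin n) × EuclideanSpace ℝ (Fin n) =>
      (S.A q.1, S.A q.2)) '' (S.upSet b i ×ˢ S.lowSet a j)) :=
    ((S.isCompact_upSet b i).prod (S.isCompact_lowSet a j)).image (by fun_prop)
  obtain ⟨_, ⟨q, hq, rfl⟩, hmax⟩ := S.os.exists_affinity_max hc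
    ((Set.Nonempty.prod i.2 j.2).image _) (by
      rintro _ ⟨q, hq, rfl⟩
      exact hmem q hq)
  refine ⟨q, hq, fun q' hq' => ?_⟩
  exact Real.log_le_log (S.os.affinity_pos (hmem q' hq').1 (hmem q' hq').2)
    (hmax _ ⟨q', hq', rfl⟩)

theorem nonempty_testChoice (K : ℕ) : Nonempty (S.TestChoice K) := by
  classical
  choose q hq hmax using fun (a b : ℝ) (i : S.UpIdx b) (j : S.LowIdx a) => S.exists_maximizer i j
  have hp : ∀ a b : ℝ, ∃ (g : S.UpIdx b → ℝ) (h : S.LowIdx a → ℝ),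
      S.LowerFeasible a → 0 ≤ g ∧ 0 ≤ h ∧ (g ≠ 0 ∨ h ≠ 0) ∧
      (S.riskMatrix K (fun i j => (q a b i j).1) fun i j => (q a b i j).2).mulVec h =
        spectralNorm₂ (S.riskMatrix K (fun i j => (q a b i j).1) fun i j => (q a b i j).2) • g ∧
      (S.riskMatrix K (fun i j => (q a b i j).1) fun i j => (q a b i j).2).transpose.mulVec g =
        spectralNorm₂ (S.riskMatrix K (fun i j => (q a b i j).1) fun i j => (q a b i j).2) •
          h := by
    intro a b
    by_cases ha : S.LowerFeasible a
    · have : Nonempty (S.LowIdx a) := ha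
      obtain ⟨g, h, H⟩ := exists_perron_vectors
        (S.riskMatrix K (fun i j => (q a b i j).1) fun i j => (q a b i j).2)
        fun i j => pow_nonneg (MeasureTheory.integral_nonneg fun ω => Real.sqrt_nonneg _) K
      exact ⟨g, h, fun _ => H⟩
    · exact ⟨0, 0, fun h => absurd h ha⟩
  choose g h H using hp
  exact ⟨⟨fun a b i j => (q a b i j).1, fun a b i j => (q a b i j).2,
    fun a b _ i j => hq a b i j, fun a b _ i j => hmax a b i j, fun a b => g a b,
    fun a b => h a b, fun a b _ ha _ => H a b ha⟩⟩

/-! ### Risks of the color, right and left tests -/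

namespace TestChoice

variable {S} {K : ℕ} (T : S.TestChoice K) {a b : ℝ}

lemma A_r_mem (hab : a < b) (i : S.UpIdx b) (j : S.LowIdx a) : S.A (T.r a b i j) ∈ S.os.params :=
  S.A_mem_params (S.upSet_subset_signals _ _ (T.mem a b hab i j).1)

lemma A_s_mem (hab : a < b) (i : S.UpIdx b) (j : S.LowIdx a) : S.A (T.s a b i j) ∈ S.os.params :=
  S.A_mem_params (S.lowSet_subset_signals _ _ (T.mem a b hab i j).2)

lemma affinity_le (hab : a < b) (i : S.UpIdx b) (j : S.LowIdx a)
    {x y : EuclideanSpace ℝ (Fin n)} (hx : x ∈ S.upSet b i) (hy : y ∈ S.lowSet a j) :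
    S.os.affinity (S.A x) (S.A y) ≤ S.os.affinity (S.A (T.r a b i j)) (S.A (T.s a b i j)) :=
  (Real.log_le_log_iff
    (S.os.affinity_pos (S.A_mem_params (S.upSet_subset_signals _ _ hx))
      (S.A_mem_params (S.lowSet_subset_signals _ _ hy)))
    (S.os.affinity_pos (T.A_r_mem hab i j) (T.A_s_mem hab i j))).1
    (T.isMaxOn a b hab i j (Set.mk_mem_prod hx hy))

lemma tilt_up_le (hab : a < b) (i : S.UpIdx b) (j : S.LowIdx a)
    {x : EuclideanSpace ℝ (Fin n)} (hx : x ∈ S.upSet b i) :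
    S.os.tilt (S.A (T.s a b i j)) (S.A (T.r a b i j)) (S.A x) ≤
      S.os.affinity (S.A (T.r a b i j)) (S.A (T.s a b i j)) := by
  refine S.os.tilt_le_affinity (C := S.A '' S.upSet b i) ((S.convex_upSet b i).affine_image S.A)
    ?_ (T.A_s_mem hab i j) ⟨_, (T.mem a b hab i j).1, rfl⟩ ?_ ⟨x, hx, rfl⟩
  · rintro _ ⟨y, hy, rfl⟩
    exact S.A_mem_params (S.upSet_subset_signals _ _ hy)
  · rintro _ ⟨y, hy, rfl⟩
    exact T.affinity_le hab i j hy (T.mem a b hab i j).2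

lemma tilt_low_le (hab : a < b) (i : S.UpIdx b) (j : S.LowIdx a)
    {x : EuclideanSpace ℝ (Fin n)} (hx : x ∈ S.lowSet a j) :
    S.os.tilt (S.A (T.r a b i j)) (S.A (T.s a b i j)) (S.A x) ≤
      S.os.affinity (S.A (T.r a b i j)) (S.A (T.s a b i j)) := by
  rw [S.os.affinity_comm]
  refine S.os.tilt_le_affinity (C := S.A '' S.lowSet a j) ((S.convex_lowSet a j).affine_image S.A)
    ?_ (T.A_r_mem hab i j) ⟨_, (T.mem a b hab i j).2, rfl⟩ ?_ ⟨x, hx, rfl⟩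
  · rintro _ ⟨y, hy, rfl⟩
    exact S.A_mem_params (S.lowSet_subset_signals _ _ hy)
  · rintro _ ⟨y, hy, rfl⟩
    rw [S.os.affinity_comm, S.os.affinity_comm (S.A (T.s a b i j))]
    exact T.affinity_le hab i j (T.mem a b hab i j).1 hy

lemma riskMatrix_pos (hab : a < b) (i : S.UpIdx b) (j : S.LowIdx a) :
    0 < S.riskMatrix K (T.r a b) (T.s a b) i j :=
  pow_pos (S.os.affinity_pos (T.A_r_mem hab i j) (T.A_s_mem hab i j)) K

lemma perron_pos (hab : a < b) (ha : S.LowerFeasible a) (hb : S.UpperFeasible b) :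
    0 < spectralNorm₂ (S.riskMatrix K (T.r a b) (T.s a b)) ∧
      (∀ i, 0 < T.g a b i) ∧ ∀ j, 0 < T.h a b j := by
  have : Nonempty (S.LowIdx a) := ha
  have : Nonempty (S.UpIdx b) := hb
  obtain ⟨h1, h2, h3, h4, h5⟩ := T.perron a b hab ha hb
  exact perron_vectors_pos (T.riskMatrix_pos hab) (spectralNorm₂_nonneg _) h1 h2 h3 h4 h5

/-- The color test errs with probability at most its risk on the upper signals. -/
lemma law_not_colorRight_le (hab : a < b) (ha : S.LowerFeasible a)
    {x : EuclideanSpace ℝ (Fin n)} (hx : x ∈ S.signals) (hfx : b ≤ S.f x) :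
    (S.os.law (S.A x) K).real {w | ¬ T.ColorRight a b w} ≤
      spectralNorm₂ (S.riskMatrix K (T.r a b) (T.s a b)) := by
  have hb := S.upperFeasible_of_le hx hfx
  obtain ⟨-, -, -, hE, -⟩ := T.perron a b hab ha hb
  obtain ⟨-, hg, hh⟩ := T.perron_pos hab ha hb
  obtain ⟨i, hi⟩ := S.exists_mem_upSet hx hfx
  have hAx := S.A_mem_params hx
  have := S.os.isProbabilityMeasure_law hAx K
  set σ := spectralNorm₂ (S.riskMatrix K (T.r a b) (T.s a b))
  have hsub : {w | ¬ T.ColorRight a b w} ⊆ ⋃ j, {w | -Real.log (T.h a b j / T.g a b i) ≤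
      S.os.detector (S.A (T.s a b i j)) (S.A (T.r a b i j)) w} := by
    intro w hw
    simp only [ColorRight, Set.mem_ofPred_eq, not_exists, not_forall, not_le] at hw
    -- The answer "left" means that every row has a negative entry, in particular the row `i` whose
    -- set contains `x`.
    obtain ⟨j, hj⟩ := hw i
    refine Set.mem_iUnion.2 ⟨j, ?_⟩
    rw [Set.mem_ofPred_eq, ← S.os.detector_neg]
    linarith
  calc (S.os.law (S.A x) K).real {w | ¬ T.ColorRight a b w}
      ≤ (S.os.law (S.A x) K).real (⋃ j, {w | -Real.log (T.h a b j / T.g a b i) ≤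
          S.os.detector (S.A (T.s a b i j)) (S.A (T.r a b i j)) w}) := measureReal_mono hsub
    _ ≤ ∑ j, (S.os.law (S.A x) K).real {w | -Real.log (T.h a b j / T.g a b i) ≤
          S.os.detector (S.A (T.s a b i j)) (S.A (T.r a b i j)) w} :=
        measureReal_iUnion_fintype_le _
    _ ≤ ∑ j, S.riskMatrix K (T.r a b) (T.s a b) i j * T.h a b j / T.g a b i := by
        refine Finset.sum_le_sum fun j _ => ?_
        refine (S.os.law_le_detector (T.A_s_mem hab i j) (T.A_r_mem hab i j) hAx _).trans ?_
        rw [neg_neg, Real.exp_log (div_pos (hh j) (hg i)), mul_comm, ← mul_div_assoc]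
        refine div_le_div_of_nonneg_right (mul_le_mul_of_nonneg_right ?_ (hh j).le) (hg i).le
        exact pow_le_pow_left₀ (S.os.tilt_pos (T.A_s_mem hab i j) (T.A_r_mem hab i j) hAx).le
          (T.tilt_up_le hab i j hi) K
    _ = σ := by
        rw [← Finset.sum_div]
        have : ∑ j, S.riskMatrix K (T.r a b) (T.s a b) i j * T.h a b j = σ * T.g a b i :=
          congrFun hE i
        rw [this, mul_div_cancel_right₀ _ (hg i).ne']

/-- The color test errs with probability at most its risk on the lower signals. -/
lemma law_colorRight_le (hab : a < b) (hb : S.UpperFeasible b)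
    {x : EuclideanSpace ℝ (Fin n)} (hx : x ∈ S.signals) (hfx : S.f x ≤ a) :
    (S.os.law (S.A x) K).real {w | T.ColorRight a b w} ≤
      spectralNorm₂ (S.riskMatrix K (T.r a b) (T.s a b)) := by
  have ha := S.lowerFeasible_of_le hx hfx
  obtain ⟨-, -, -, -, hE⟩ := T.perron a b hab ha hb
  obtain ⟨-, hg, hh⟩ := T.perron_pos hab ha hb
  obtain ⟨j, hj⟩ := S.exists_mem_lowSet hx hfx
  have hAx := S.A_mem_params hx
  have := S.os.isProbabilityMeasure_law hAx K
  set σ := spectralNorm₂ (S.riskMatrix K (T.r a b) (T.s a b))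
  have hsub : {w | T.ColorRight a b w} ⊆ ⋃ i, {w | Real.log (T.h a b j / T.g a b i) ≤
      S.os.detector (S.A (T.r a b i j)) (S.A (T.s a b i j)) w} := by
    rintro w ⟨i, hi⟩
    -- The answer "right" makes some row nonnegative throughout, in particular at the column `j`
    -- whose set contains `x`.
    exact Set.mem_iUnion.2 ⟨i, sub_nonneg.1 (hi j)⟩
  calc (S.os.law (S.A x) K).real {w | T.ColorRight a b w}
      ≤ (S.os.law (S.A x) K).real (⋃ i, {w | Real.log (T.h a b j / T.g a b i) ≤
          S.os.detector (S.A (T.r a b i j)) (S.A (T.s a b i j)) w}) := measureReal_mono hsub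
    _ ≤ ∑ i, (S.os.law (S.A x) K).real {w | Real.log (T.h a b j / T.g a b i) ≤
          S.os.detector (S.A (T.r a b i j)) (S.A (T.s a b i j)) w} :=
        measureReal_iUnion_fintype_le _
    _ ≤ ∑ i, S.riskMatrix K (T.r a b) (T.s a b) i j * T.g a b i / T.h a b j := by
        refine Finset.sum_le_sum fun i _ => ?_
        refine (S.os.law_le_detector (T.A_r_mem hab i j) (T.A_s_mem hab i j) hAx _).trans ?_
        rw [Real.exp_neg, Real.exp_log (div_pos (hh j) (hg i)), inv_div, mul_comm,
          ← mul_div_assoc]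
        refine div_le_div_of_nonneg_right (mul_le_mul_of_nonneg_right ?_ (hg i).le) (hh j).le
        exact pow_le_pow_left₀ (S.os.tilt_pos (T.A_r_mem hab i j) (T.A_s_mem hab i j) hAx).le
          (T.tilt_low_le hab i j hj) K
    _ = σ := by
        rw [← Finset.sum_div]
        have : ∑ i, S.riskMatrix K (T.r a b) (T.s a b) i j * T.g a b i = σ * T.h a b j :=
          congrFun hE j
        rw [this, mul_div_cancel_right₀ _ (hh j).ne']

variable {δ : ℝ} {x : EuclideanSpace ℝ (Fin n)}

/-- The signal itself witnesses that `b` is upper-feasible, so the degenerate test that always says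
"left" does not occur here. In `law_rightTest_le` it can occur, but there "left" is the correct
answer. -/
lemma law_not_rightTest_le (hG : T.GoodRight δ a b) (hx : x ∈ S.signals) (hfx : b ≤ S.f x) :
    (S.os.law (S.A x) K).real {w | ¬ T.RightTest a b w} ≤ δ := by
  obtain ⟨ha, hab, hδ⟩ := hG
  have hb := S.upperFeasible_of_le hx hfx
  rw [rightRisk, if_pos hb] at hδ
  simpa [RightTest, hb] using (T.law_not_colorRight_le hab ha hx hfx).trans hδ

lemma law_rightTest_le (hG : T.GoodRight δ a b) (hx : x ∈ S.signals) (hfx : S.f x ≤ a) :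
    (S.os.law (S.A x) K).real {w | T.RightTest a b w} ≤ δ := by
  obtain ⟨ha, hab, hδ⟩ := hG
  by_cases hb : S.UpperFeasible b
  · rw [rightRisk, if_pos hb] at hδ
    simpa [RightTest, hb] using (T.law_colorRight_le hab hb hx hfx).trans hδ
  · rw [rightRisk, if_neg hb] at hδ
    simpa [RightTest, hb] using hδ

lemma law_not_leftTest_le (hG : T.GoodLeft δ a b) (hx : x ∈ S.signals) (hfx : b ≤ S.f x) :
    (S.os.law (S.A x) K).real {w | ¬ T.LeftTest a b w} ≤ δ := by
  obtain ⟨hb, hab, hδ⟩ := hG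
  by_cases ha : S.LowerFeasible a
  · rw [leftRisk, if_pos ha, rightRisk, if_pos hb] at hδ
    simpa [LeftTest, RightTest, ha, hb] using (T.law_not_colorRight_le hab ha hx hfx).trans hδ
  · rw [leftRisk, if_neg ha] at hδ
    simpa [LeftTest, ha] using hδ

lemma law_leftTest_le (hG : T.GoodLeft δ a b) (hx : x ∈ S.signals) (hfx : S.f x ≤ a) :
    (S.os.law (S.A x) K).real {w | T.LeftTest a b w} ≤ δ := by
  obtain ⟨hb, hab, hδ⟩ := hG
  have ha := S.lowerFeasible_of_le hx hfx
  rw [leftRisk, if_pos ha, rightRisk, if_pos hb] at hδ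
  simpa [LeftTest, RightTest, ha, hb] using (T.law_colorRight_le hab hb hx hfx).trans hδ

lemma measurableSet_colorRight (hab : a < b) : MeasurableSet {w | T.ColorRight a b w} := by
  simp only [ColorRight, Set.ofPred_exists, Set.ofPred_forall]
  refine MeasurableSet.iUnion fun i => MeasurableSet.iInter fun j => ?_
  exact measurableSet_le measurable_const
    ((S.os.measurable_detector (T.A_r_mem hab i j) (T.A_s_mem hab i j)).sub_const _)

lemma measurableSet_rightTest (hab : a < b) : MeasurableSet {w | T.RightTest a b w} :=
  (MeasurableSet.const _).inter (T.measurableSet_colorRight hab)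

lemma measurableSet_leftTest (hab : a < b) : MeasurableSet {w | T.LeftTest a b w} := by
  by_cases ha : S.LowerFeasible a
  · simpa [LeftTest, ha] using T.measurableSet_rightTest hab
  · simp [LeftTest, ha]

/-- If signals that differ by at least `b - a` in `f` can be told apart by some estimate, then the
risk of the color test is small. -/
lemma spectralNorm_le {Kbar : ℕ} {ρbar ε t : ℝ} (hε : 0 < ε) (hε' : ε < 1 / 2)
    (hKbar : 0 < Kbar) {fhat : (Fin Kbar → Ω) → ℝ} (hf : S.IsReliable fhat ρbar ε)
    (ht : 0 < t) (hK : Real.log t⁻¹ * (2 * Kbar) ≤ Real.log (4 * ε * (1 - ε))⁻¹ * K)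
    (ha : S.LowerFeasible a) (hb : S.UpperFeasible b) (hab : a < b) (hgap : 2 * ρbar < b - a) :
    spectralNorm₂ (S.riskMatrix K (T.r a b) (T.s a b)) ≤ (N * I : ℕ) * t := by
  have : Nonempty (S.LowIdx a) := ha
  have : Nonempty (S.UpIdx b) := hb
  obtain ⟨-, hg, hh⟩ := T.perron_pos hab ha hb
  obtain ⟨-, -, -, h4, h5⟩ := T.perron a b hab ha hb
  refine perron_value_le ht.le (fun i j => ?_) (Nat.cast_le.2 (S.card_upIdx_le b))
    (Nat.cast_le.2 (S.card_lowIdx_le a)) hg hh h4 h5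
  have hr := (T.mem a b hab i j).1
  have hs := (T.mem a b hab i j).2
  have hrA := T.A_r_mem hab i j
  have hsA := T.A_s_mem hab i j
  have hpos := S.os.affinity_pos hrA hsA
  -- The separating event is that `fhat` is `ρbar`-close to `f` at the upper point. It excludes
  -- `ρbar`-closeness at the lower point, since the two values of `f` differ by more than `2 ρbar`.
  have hB : MeasurableSet {w | |fhat w - S.f (T.r a b i j)| ≤ ρbar} :=
    measurableSet_le (hf.1.sub_const _).abs measurable_const
  have := S.os.isProbabilityMeasure_law hsA Kbar
  have hq := S.os.affinity_pow_le hrA hsA hB hε hε'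
    (hf.2 _ (S.upSet_subset_signals _ _ hr))
    ((hf.2 _ (S.lowSet_subset_signals _ _ hs)).trans (measureReal_mono fun w hw hw' => by
      simp only [Set.mem_ofPred_eq] at hw hw'
      have h1 := S.le_f_of_mem_upSet hr
      have h2 := S.f_le_of_mem_lowSet hs
      have h3 := abs_le.1 hw
      have h4 := abs_le.1 hw'
      linarith))
  change S.os.affinity (S.A (T.r a b i j)) (S.A (T.s a b i j)) ^ K ≤ t
  set e := S.os.affinity (S.A (T.r a b i j)) (S.A (T.s a b i j))
  have hx : 0 < 4 * ε * (1 - ε) := by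
    have : 0 < 1 - ε := by linarith
    positivity
  -- Squaring removes the root; raising to the power `K / (2 Kbar)`, done through logarithms, then
  -- yields `e ^ K ≤ t`.
  have hq2 : e ^ (2 * Kbar) ≤ 4 * ε * (1 - ε) := by
    rw [mul_comm, pow_mul]
    refine (pow_le_pow_left₀ (by positivity) hq 2).trans (le_of_eq ?_)
    rw [mul_pow, Real.sq_sqrt (by nlinarith)]
    ring
  have hl := Real.log_le_log (by positivity) hq2
  rw [Real.log_pow] at hl
  rw [← Real.log_le_log_iff (by positivity) ht, Real.log_pow]
  rw [Real.log_inv, Real.log_inv] at hK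
  push_cast at hl
  have hKb : (0 : ℝ) < 2 * Kbar := by positivity
  have hK0 : (0 : ℝ) ≤ K := Nat.cast_nonneg K
  have := mul_le_mul_of_nonneg_left hl hK0
  refine le_of_mul_le_mul_right ?_ hKb
  linarith

/-! ### Separators, and the coverage, measurability and length of Bisection's output -/

variable {c ϰ : ℝ}

lemma sepRight_spec (hϰ : 0 < ϰ) (h : T.GoodRight δ c b) :
    T.GoodRight δ c (T.sepRight δ ϰ c b) ∧ T.sepRight δ ϰ c b ≤ b ∧
      ¬ T.GoodRight δ c (T.sepRight δ ϰ c b - ϰ) := by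
  have hne : {k : ℕ | ¬ T.GoodRight δ c (b - k * ϰ)}.Nonempty := by
    obtain ⟨k, hk⟩ := Archimedean.arch (b - c) hϰ
    rw [nsmul_eq_mul] at hk
    exact ⟨k, fun hG => by linarith [hG.2.1]⟩
  have hmem := Nat.sInf_mem hne
  have hmin := fun m => Nat.notMem_of_lt_sInf (m := m) (s := {k : ℕ | ¬ T.GoodRight δ c (b - k * ϰ)})
  unfold sepRight
  -- Index `0` is good by hypothesis, so the first bad index is some `m + 1`; the separator uses
  -- `m`, which is still good, and one more shift by `ϰ` reaches the bad segment.
  rcases hk : sInf {k : ℕ | ¬ T.GoodRight δ c (b - k * ϰ)} with - | m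
  · rw [hk] at hmem
    exact absurd h (by simpa using hmem)
  · rw [hk] at hmem hmin
    have h1 := hmin m (Nat.lt_succ_self m)
    rw [Set.mem_ofPred_eq, not_not] at h1
    rw [Set.mem_ofPred_eq] at hmem
    push_cast at hmem ⊢
    rw [add_sub_cancel_right]
    refine ⟨h1, sub_le_self _ (by positivity), ?_⟩
    convert hmem using 2
    ring

lemma sepLeft_spec (hϰ : 0 < ϰ) (h : T.GoodLeft δ a c) :
    T.GoodLeft δ (T.sepLeft δ ϰ a c) c ∧ a ≤ T.sepLeft δ ϰ a c ∧
      ¬ T.GoodLeft δ (T.sepLeft δ ϰ a c + ϰ) c := by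
  have hne : {k : ℕ | ¬ T.GoodLeft δ (a + k * ϰ) c}.Nonempty := by
    obtain ⟨k, hk⟩ := Archimedean.arch (c - a) hϰ
    rw [nsmul_eq_mul] at hk
    exact ⟨k, fun hG => by linarith [hG.2.1]⟩
  have hmem := Nat.sInf_mem hne
  have hmin := fun m => Nat.notMem_of_lt_sInf (m := m) (s := {k : ℕ | ¬ T.GoodLeft δ (a + k * ϰ) c})
  unfold sepLeft
  rcases hk : sInf {k : ℕ | ¬ T.GoodLeft δ (a + k * ϰ) c} with - | m
  · rw [hk] at hmem
    exact absurd h (by simpa using hmem)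
  · rw [hk] at hmem hmin
    have h1 := hmin m (Nat.lt_succ_self m)
    rw [Set.mem_ofPred_eq, not_not] at h1
    rw [Set.mem_ofPred_eq] at hmem
    push_cast at hmem ⊢
    rw [add_sub_cancel_right]
    refine ⟨h1, le_add_of_nonneg_right (by positivity), ?_⟩
    convert hmem using 2
    ring

/-- Each step of Bisection loses the value of `f` with probability at most `2 * δ`. -/
theorem law_bisection_fail_le (hδ : 0 ≤ δ) (hϰ : 0 < ϰ) (hx : x ∈ S.signals) :
    ∀ (m : ℕ) (a b : ℝ), a < b → S.f x ∈ Set.Icc a b →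
      (S.os.law (S.A x) K).real {w | S.f x ∉ Set.Icc (T.bisection δ ϰ w m a b).1
        (T.bisection δ ϰ w m a b).2} ≤ 2 * m * δ := by
  have hP := S.os.isProbabilityMeasure_law (S.A_mem_params hx) K
  intro m
  induction m with
  | zero =>
    intro a b _ hf
    simp [bisection, hf.1, hf.2]
  | succ m ih =>
    intro a b hab hf
    simp only [bisection]
    have hstep : 2 * (m : ℝ) * δ ≤ 2 * ((m + 1 : ℕ) : ℝ) * δ := by push_cast; linarith
    have h0 : 0 ≤ 2 * ((m + 1 : ℕ) : ℝ) * δ := by positivity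
    set c := (a + b) / 2 with hc
    have hac : a < c := by linarith
    have hcb : c < b := by linarith
    by_cases hU : S.UpperFeasible c
    swap
    · simp only [hU, not_false_eq_true, if_true]
      have hfc : S.f x ≤ c := le_of_not_ge fun h => hU (S.upperFeasible_of_le hx h)
      exact (ih a c hac ⟨hf.1, hfc⟩).trans hstep
    by_cases hL : S.LowerFeasible c
    swap
    · simp only [hU, hL, not_true, not_false_eq_true, if_true, if_false]
      have hfc : c ≤ S.f x := le_of_not_ge fun h => hL (S.lowerFeasible_of_le hx h)
      exact (ih c b hcb ⟨hfc, hf.2⟩).trans hstep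
    by_cases hR : T.GoodRight δ c b
    swap
    · simpa [hU, hL, hR, hf.1, hf.2] using h0
    by_cases hLe : T.GoodLeft δ a c
    swap
    · simpa [hU, hL, hR, hLe, hf.1, hf.2] using h0
    simp only [hU, hL, hR, hLe, not_true, if_false]
    obtain ⟨hv, hvb, -⟩ := T.sepRight_spec hϰ hR
    obtain ⟨hu, hau, -⟩ := T.sepLeft_spec hϰ hLe
    set v := T.sepRight δ ϰ c b
    set u := T.sepLeft δ ϰ a c
    have huc : u < c := hu.2.1
    have hcv : c < v := hv.2.1
    have hsplit : 2 * ((m + 1 : ℕ) : ℝ) * δ = δ + δ + 2 * m * δ := by push_cast; ring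
    rw [hsplit]
    rcases le_total c (S.f x) with hfc | hfc
    · have h1 := T.law_not_leftTest_le hu hx hfc
      -- The right test of `[c, v]` carries a guarantee only when `v ≤ f x`; for `c ≤ f x < v`
      -- either of its answers is harmless.
      have h2 : (S.os.law (S.A x) K).real {w | v ≤ S.f x ∧ ¬ T.RightTest c v w} ≤ δ := by
        by_cases hvf : v ≤ S.f x
        · simpa [hvf] using T.law_not_rightTest_le hv hx hvf
        · simpa [hvf] using hδ
      -- The recursion is bounded on the fixed segment `[c, b]`, not conditionally on the answers,
      -- so the same observation can be reused at every step.
      have h3 := ih c b hcb ⟨hfc, hf.2⟩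
      refine (measureReal_mono ?_).trans (((measureReal_union_le _ _).trans
        (add_le_add_left (measureReal_union_le _ _) _)).trans (add_le_add (add_le_add h1 h2) h3))
      intro w hw
      by_contra hw'
      simp only [Set.mem_union, Set.mem_ofPred_eq, not_or, not_not, not_and] at hw' hw
      obtain ⟨⟨hLt, hRt⟩, hrec⟩ := hw'
      by_cases hRw : T.RightTest c v w
      · simp only [hRw, hLt, and_self, if_true] at hw
        exact hw hrec
      -- The tests disagree and the output is `[u, v]`: `u < c ≤ f x`, and the answer "left" of the
      -- right test rules out `v ≤ f x`.
      · simp only [hRw, hLt, false_and, not_true, and_false, if_false] at hw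
        exact hw ⟨by linarith, le_of_not_ge fun h => hRw (hRt h)⟩
    · have h1 := T.law_rightTest_le hv hx hfc
      have h2 : (S.os.law (S.A x) K).real {w | S.f x ≤ u ∧ T.LeftTest u c w} ≤ δ := by
        by_cases huf : S.f x ≤ u
        · simpa [huf] using T.law_leftTest_le hu hx huf
        · simpa [huf] using hδ
      have h3 := ih a c hac ⟨hf.1, hfc⟩
      refine (measureReal_mono ?_).trans (((measureReal_union_le _ _).trans
        (add_le_add_left (measureReal_union_le _ _) _)).trans (add_le_add (add_le_add h1 h2) h3))
      intro w hw
      by_contra hw'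
      simp only [Set.mem_union, Set.mem_ofPred_eq, not_or, not_not, not_and] at hw' hw
      obtain ⟨⟨hRt, hLt⟩, hrec⟩ := hw'
      by_cases hLw : T.LeftTest u c w
      · simp only [hRt, hLw, false_and, not_true, and_false, if_false] at hw
        exact hw ⟨le_of_not_ge fun h => hLt h hLw, by linarith⟩
      · simp only [hRt, hLw, and_self, not_false_eq_true, if_true, if_false] at hw
        exact hw hrec

/-- The output segment of `L` steps of Bisection covers `f x` with probability at least
`1 - 2 * L * δ`. -/
theorem le_law_bisection (hδ : 0 ≤ δ) (hϰ : 0 < ϰ) (hx : x ∈ S.signals) (m : ℕ) (hab : a < b)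
    (hf : S.f x ∈ Set.Icc a b) :
    1 - 2 * m * δ ≤ (S.os.law (S.A x) K).real {w | S.f x ∈ Set.Icc
      (T.bisection δ ϰ w m a b).1 (T.bisection δ ϰ w m a b).2} := by
  have hP := S.os.isProbabilityMeasure_law (S.A_mem_params hx) K
  have h1 := T.law_bisection_fail_le hδ hϰ hx m a b hab hf
  have h2 := measureReal_union_le (μ := S.os.law (S.A x) K)
    {w | S.f x ∈ Set.Icc (T.bisection δ ϰ w m a b).1 (T.bisection δ ϰ w m a b).2}
    {w | S.f x ∉ Set.Icc (T.bisection δ ϰ w m a b).1 (T.bisection δ ϰ w m a b).2}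
  have h3 : {w | S.f x ∈ Set.Icc (T.bisection δ ϰ w m a b).1 (T.bisection δ ϰ w m a b).2} ∪
      {w | S.f x ∉ Set.Icc (T.bisection δ ϰ w m a b).1 (T.bisection δ ϰ w m a b).2} =
      Set.univ := Set.union_compl_self _
  rw [h3, probReal_univ] at h2
  linarith

/-- Only the answers of the two tests depend on `w`. The bound `a < b` passes to all segments met,
and the maximizers of the tests are controlled only for such segments. -/
lemma measurable_bisection (hϰ : 0 < ϰ) :
    ∀ (m : ℕ) (a b : ℝ), a < b → Measurable fun w => T.bisection δ ϰ w m a b := by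
  intro m
  induction m with
  | zero => exact fun a b _ => measurable_const
  | succ m ih =>
    intro a b hab
    simp only [bisection]
    set c := (a + b) / 2 with hc
    have hac : a < c := by linarith
    have hcb : c < b := by linarith
    by_cases hU : S.UpperFeasible c
    swap
    · simpa [hU] using ih a c hac
    by_cases hL : S.LowerFeasible c
    swap
    · simpa [hU, hL] using ih c b hcb
    by_cases hR : T.GoodRight δ c b
    swap
    · simp [hU, hL, hR]
    by_cases hLe : T.GoodLeft δ a c
    swap
    · simp [hU, hL, hR, hLe]
    simp only [hU, hL, hR, hLe, not_true, if_false]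
    have hv := T.measurableSet_rightTest (T.sepRight_spec hϰ hR).1.2.1
    have hu := T.measurableSet_leftTest (T.sepLeft_spec hϰ hLe).1.2.1
    exact Measurable.ite (hv.inter hu) (ih c b hcb)
      (Measurable.ite (hv.compl.inter hu.compl) (ih a c hac) measurable_const)

variable {r : ℝ}

/-- A long segment is good in either case: by `H` when both ends are feasible, and otherwise because
the degenerate test has risk `0`. -/
lemma sub_le_of_not_goodRight (hδ : 0 ≤ δ) (hr : 0 ≤ r)
    (H : ∀ a b, a < b → S.LowerFeasible a → S.UpperFeasible b → r < b - a →
      spectralNorm₂ (S.riskMatrix K (T.r a b) (T.s a b)) ≤ δ)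
    (ha : S.LowerFeasible a) (hG : ¬ T.GoodRight δ a b) : b - a ≤ r := by
  by_contra! hlt
  have hab : a < b := by linarith
  refine hG ⟨ha, hab, ?_⟩
  unfold rightRisk
  split_ifs with hb
  exacts [H a b hab ha hb hlt, hδ]

lemma sub_le_of_not_goodLeft (hδ : 0 ≤ δ) (hr : 0 ≤ r)
    (H : ∀ a b, a < b → S.LowerFeasible a → S.UpperFeasible b → r < b - a →
      spectralNorm₂ (S.riskMatrix K (T.r a b) (T.s a b)) ≤ δ)
    (hb : S.UpperFeasible b) (hG : ¬ T.GoodLeft δ a b) : b - a ≤ r := by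
  by_contra! hlt
  have hab : a < b := by linarith
  refine hG ⟨hb, hab, ?_⟩
  rw [leftRisk, rightRisk, if_pos hb]
  split_ifs with ha
  exacts [H a b hab ha hb hlt, hδ]

/-- The length of the output segment of Bisection when all long segments have small risk. -/
theorem bisection_length_le (hδ : 0 ≤ δ) (hϰ : 0 < ϰ) (hr : 0 ≤ r)
    (H : ∀ a b, a < b → S.LowerFeasible a → S.UpperFeasible b → r < b - a →
      spectralNorm₂ (S.riskMatrix K (T.r a b) (T.s a b)) ≤ δ) (w : Fin K → Ω) :
    ∀ (m : ℕ) (a b : ℝ), b - a ≤ 2 ^ m * (2 * (r + ϰ)) →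
      (T.bisection δ ϰ w m a b).2 - (T.bisection δ ϰ w m a b).1 ≤ 2 * (r + ϰ) := by
  intro m
  induction m with
  | zero => intro a b h; simpa [bisection] using h
  | succ m ih =>
    intro a b hab
    rw [pow_succ] at hab
    simp only [bisection]
    set c := (a + b) / 2 with hc
    have h1 := ih a c (by linarith)
    have h2 := ih c b (by linarith)
    split_ifs with hU hL hR hLe
    · exact h2
    · exact h1
    -- `[c, v - ϰ]` and `[u + ϰ, c]` are not good, so each has length at most `r`.
    · have e1 := T.sub_le_of_not_goodRight hδ hr H hL (T.sepRight_spec hϰ hR).2.2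
      have e2 := T.sub_le_of_not_goodLeft hδ hr H hU (T.sepLeft_spec hϰ hLe).2.2
      change T.sepRight δ ϰ c b - T.sepLeft δ ϰ a c ≤ _
      linarith
    -- A half of `[a, b]` is not good, so `b - a ≤ 2 r`.
    · have := T.sub_le_of_not_goodLeft hδ hr H hU hLe
      change b - a ≤ _
      linarith
    · have := T.sub_le_of_not_goodRight hδ hr H hL hR
      change b - a ≤ _
      linarith
    · exact h2
    · exact h1

lemma measurable_estimate (hϰ : 0 < ϰ) (L : ℕ) (hab : a < b) :
    Measurable (T.estimate δ ϰ L a b) := by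
  have := T.measurable_bisection (δ := δ) hϰ L a b hab
  exact (this.fst.add this.snd).div_const 2

/-- The Bisection estimate is reliable when all long segments have small risk. -/
theorem isReliable_estimate (hδ : 0 ≤ δ) (hϰ : 0 < ϰ) (hr : 0 ≤ r)
    (H : ∀ a b, a < b → S.LowerFeasible a → S.UpperFeasible b → r < b - a →
      spectralNorm₂ (S.riskMatrix K (T.r a b) (T.s a b)) ≤ δ) {L : ℕ} (hab : a < b)
    (hL : b - a ≤ 2 ^ L * (2 * (r + ϰ))) (hf : ∀ x ∈ S.signals, S.f x ∈ Set.Icc a b) :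
    S.IsReliable (T.estimate δ ϰ L a b) (r + ϰ) (2 * L * δ) := by
  refine ⟨T.measurable_estimate hϰ L hab, fun x hx => ?_⟩
  have hP := S.os.isProbabilityMeasure_law (S.A_mem_params hx) K
  refine (T.le_law_bisection hδ hϰ hx L hab (hf x hx)).trans (measureReal_mono fun w hw => ?_)
  have h1 := T.bisection_length_le hδ hϰ hr H w L a b hL
  obtain ⟨h2, h3⟩ := hw
  rw [Set.mem_ofPred_eq, estimate, abs_le]
  constructor <;> linarith

end TestChoice

end EstimationProblem

/-! ### Assembly: the parameters of the proposition -/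

theorem proposition4p2 {Ω : Type*} [TopologicalSpace Ω] [PolishSpace Ω] [MeasurableSpace Ω]
    [BorelSpace Ω] {M n I N : ℕ} (S : EstimationProblem Ω M n I N)
    (a₀ b₀ : ℝ) (hab : a₀ < b₀) (ha₀ : ∀ x ∈ S.signals, a₀ ≤ S.f x)
    (hb₀ : ∀ x ∈ S.signals, S.f x ≤ b₀) (ε : ℝ) (hε : 0 < ε) (hε' : ε < 1 / 2) :
    -- the optimal solutions and eigenvectors used by the tests exist, for every `K`
    (∀ K : ℕ, Nonempty (S.TestChoice K)) ∧
    -- (i) reliability, whichever optimal solutions and eigenvectors are used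
    (∀ (K : ℕ), 0 < K → ∀ (T : S.TestChoice K) (L : ℕ), 0 < L → ∀ ϰ : ℝ, 0 < ϰ →
      ∀ x ∈ S.signals,
        1 - ε ≤ (S.os.law (S.A x) K).real
          {w | S.f x ∈ Set.Icc (T.bisection (ε / (2 * L)) ϰ w L a₀ b₀).1
            (T.bisection (ε / (2 * L)) ϰ w L a₀ b₀).2}) ∧
    -- (ii) near-optimality; if `b₀ - a₀ ≤ 2 * ρ`, then `L = 0`, no step is made, and `K` is free
    (∀ (ρbar : ℝ) (Kbar : ℕ), 0 < ρbar → 0 < Kbar →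
      (∃ fhat : (Fin Kbar → Ω) → ℝ, S.IsReliable fhat ρbar ε) →
      ∀ ρ : ℝ, 2 * ρbar < ρ →
      ∀ L K : ℕ, L = ⌈Real.logb 2 ((b₀ - a₀) / (2 * ρ))⌉₊ →
        (0 < L → K = ⌈2 * Real.log (2 * L * N * I / ε) / Real.log ((4 * ε * (1 - ε))⁻¹)
          * Kbar⌉₊) →
        ∀ T : S.TestChoice K,
          S.IsReliable (T.estimate (ε / (2 * L)) (ρ - 2 * ρbar) L a₀ b₀) ρ ε) := by
  refine ⟨S.nonempty_testChoice, ?_, ?_⟩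
  · intro K _ T L hL ϰ hϰ x hx
    have h := T.le_law_bisection (δ := ε / (2 * L)) (by positivity) hϰ hx L hab
      ⟨ha₀ x hx, hb₀ x hx⟩
    rwa [mul_div_cancel₀ ε (by positivity : (2 * L : ℝ) ≠ 0)] at h
  · intro ρbar Kbar hρbar hKbar ⟨fhat, hfhat⟩ ρ hρ L K hL hK T
    have hϰ : 0 < ρ - 2 * ρbar := by linarith
    have hρ0 : 0 < ρ := by linarith
    have hf : ∀ x ∈ S.signals, S.f x ∈ Set.Icc a₀ b₀ := fun x hx => ⟨ha₀ x hx, hb₀ x hx⟩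
    -- The natural-number ceiling is `0` on nonpositive arguments, so this also covers `b₀ - a₀ ≤ 2
    -- ρ`.
    have hlen : b₀ - a₀ ≤ 2 ^ L * (2 * ρ) := by
      have h1 : Real.logb 2 ((b₀ - a₀) / (2 * ρ)) ≤ L := hL ▸ Nat.le_ceil _
      have h2 : 0 < (b₀ - a₀) / (2 * ρ) := div_pos (by linarith) (by linarith)
      rw [Real.logb_le_iff_le_rpow one_lt_two h2, Real.rpow_natCast,
        div_le_iff₀ (by linarith)] at h1
      exact h1
    rcases Nat.eq_zero_or_pos L with hL0 | hLpos
    -- Here `ε / (2 * 0)` takes the default value `0`, which plays no role because no step is made.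
    · subst hL0
      refine ⟨T.measurable_estimate hϰ 0 hab, fun x hx => ?_⟩
      have := S.os.isProbabilityMeasure_law (S.A_mem_params hx) K
      have huniv : {w : Fin K → Ω | |T.estimate (ε / (2 * (0 : ℕ))) (ρ - 2 * ρbar) 0 a₀ b₀ w
          - S.f x| ≤ ρ} = Set.univ := by
        refine Set.eq_univ_of_forall fun w => ?_
        have h1 := hf x hx
        rw [pow_zero, one_mul] at hlen
        change |(a₀ + b₀) / 2 - S.f x| ≤ ρ
        rw [abs_le]
        constructor <;> linarith [h1.1, h1.2]
      rw [huniv, probReal_univ]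
      linarith
    · have hLR : (0 : ℝ) < L := Nat.cast_pos.2 hLpos
      have hx0 : 0 < 4 * ε * (1 - ε) := by
        have : 0 < 1 - ε := by linarith
        positivity
      have hx1 : 4 * ε * (1 - ε) < 1 := by nlinarith [sq_pos_of_pos (sub_pos.2 hε')]
      have hlog : 0 < Real.log (4 * ε * (1 - ε))⁻¹ :=
        Real.log_pos (one_lt_inv_iff₀.2 ⟨hx0, hx1⟩)
      have hKle : 2 * Real.log (2 * L * N * I / ε) / Real.log (4 * ε * (1 - ε))⁻¹ * Kbar ≤ K :=
        hK hLpos ▸ Nat.le_ceil _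
      have hδ : 0 ≤ ε / (2 * L) := by positivity
      -- With `r = 2 ρbar`, the accuracy `r + ϰ` is `ρ`, and the failure bound `2 L δ` is `ε`.
      have key := T.isReliable_estimate hδ hϰ (r := 2 * ρbar) (L := L) (by linarith)
        (fun a b hab' ha hb hgap => ?_) hab (by simpa using hlen) hf
      · rwa [add_sub_cancel, mul_div_cancel₀ ε (by positivity : (2 * L : ℝ) ≠ 0)] at key
      · have hNI : 0 < N * I := by
          have : Nonempty (S.UpIdx b) := hb
          exact Fintype.card_pos.trans_le (S.card_upIdx_le b)
        have hNIR : (0 : ℝ) < (N * I : ℕ) := Nat.cast_pos.2 hNI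
        -- The target for the entries is `t = δ / (N I)`, so that the size factor `N I` brings the
        -- risk to `δ`; `t⁻¹` is the argument of the logarithm in `K`.
        have ht : 0 < ε / (2 * L) / (N * I : ℕ) := by positivity
        have h := T.spectralNorm_le hε hε' hKbar hfhat ht ?_ ha hb hab' hgap
        · rwa [mul_div_cancel₀ _ hNIR.ne'] at h
        · have hinv : (ε / (2 * L) / (N * I : ℕ))⁻¹ = 2 * L * N * I / ε := by
            push_cast
            field_simp
          rw [hinv]
          rw [div_mul_eq_mul_div, div_le_iff₀ hlog] at hKle
          linarith
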